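/- Let $1<\beta<2$ and $\tau_1,\tau_2>0$. There is a constant $c>0$, depending only on $\beta,\tau_1,\tau_2$, with the following property. Fix $h_0,\delta,\kappa>0$. Let $f$ be a smooth, symmetric probability density on $\mathbb R$ with $f(x)=h(x)/|x|^{1+\beta}$ for $x\neq0$, where $h$ is symmetric and $|h(x)-h_0|\le C_h(1+x^2)^{-3/2}$ for some constant $C_h$ and all $x$. Let $\sigma:\mathbb R\to[0,1]$ be smooth and symmetric with $\sigma(x)=1$ for $|x|\le a$ and $\sigma(x)=0$ for $|x|\ge b$, for some $0<a<b<1/2$. For integers $N,W\ge1$ let $\mathbb T=[-N/2,N/2)\cap\mathbb Z$, let $[x]_N\in\mathbb T$ be the representative of $x\in\mathbb Z$ modulo $N$, and define the matrix $S=(s_{xy})_{x,y\in\mathbb T}$ by $$s_{xy}=\frac1Z\,f\Big(\frac{[x-y]_N}{W}\Big)\,\sigma\Big(\frac{[x-y]_N}{N}\Big),\qquad Z=\sum_{u\in\mathbb T} f\Big(\frac uW\Big)\sigma\Big(\frac uN\Big).$$ For $z=E+\mathrm i\eta$ with $\eta>0$ and $|E|<2$ put $$m=\frac1{2\pi}\int_{-2}^2\frac{\sqrt{4-\xi^2}}{\xi-z}\,d\xi,\qquad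 \Theta=\frac{|m|^2S}{1-|m|^2S},\qquad \alpha=\frac2{\sqrt{4-E^2}},$$ $$B=h_0\frac WZ\int_{\mathbb R}\frac{1-\cos u}{|u|^{1+\beta}}\,du,\qquad V(x)=\int_{\mathbb R}\frac{dq}{2\pi}\,\frac{e^{\mathrm iqx}}{1+|q|^\beta}.$$ Then there are constants $C$ and $N_0$, depending only on $\beta,\tau_1,\tau_2,h_0,\delta,\kappa,f,\sigma$, such that for all integers $N\ge N_0$ and $W$ with $N^\delta\le W\le N$, all $E\in[-2+\kappa,2-\kappa]$ and all $\eta$ with $$\Big(\frac WN\Big)^\beta\le N^{-\tau_1}\eta,\qquad \eta\le N^{-\tau_2},$$ we have $Z>0$, the matrix $1-|m|^2S$ is invertible, and for every $x\in\mathbb T$ $$\left|\Theta_{x0}-\frac{|m|^2}{W\alpha\eta}\Big(\frac{\alpha\eta}{B}\Big)^{1/\beta}V\left(\Big(\frac{\alpha\eta}{B}\Big)^{1/\beta}\frac xW\right)\right|\le C\,\frac{\eta^{1/\beta-1}}{W^{1+c}}.$$ -/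

import Mathlib

open MeasureTheory
open scoped ContDiff

noncomputable section

namespace HeavyTailBand

/-- `f` is a smooth symmetric probability density on `ℝ` with `f x = h x / |x| ^ (1 + β)`,
where `h` is symmetric and `|h x - h₀| ≤ C ⟨x⟩⁻³`, with `⟨x⟩ = √(1 + x ^ 2)`.
(The formula for `f` is imposed at `x ≠ 0`; the value of `f` at `0` is fixed by continuity.) -/
structure IsHeavyTailedDensity (β h₀ : ℝ) (f : ℝ → ℝ) : Prop where
  smooth : ContDiff ℝ ∞ f
  symm : ∀ x, f (-x) = f x
  nonneg : ∀ x, 0 ≤ f x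
  integrable : Integrable f
  integral_eq_one : ∫ x, f x = 1
  tail : ∃ h : ℝ → ℝ, (∀ x, h (-x) = h x) ∧
    (∀ x, x ≠ 0 → f x = h x / |x| ^ (1 + β)) ∧
    ∃ C : ℝ, ∀ x, |h x - h₀| ≤ C / √(1 + x ^ 2) ^ 3

/-- `σ` is a smooth symmetric bump function with `σ = 1` on `|x| ≤ a` and `σ = 0` on `|x| ≥ b`,
for some `0 < a < b < 1/2`. -/
structure IsCutoff (σ : ℝ → ℝ) : Prop where
  smooth : ContDiff ℝ ∞ σ
  symm : ∀ x, σ (-x) = σ x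
  nonneg : ∀ x, 0 ≤ σ x
  le_one : ∀ x, σ x ≤ 1
  bump : ∃ a b : ℝ, 0 < a ∧ a < b ∧ b < 1 / 2 ∧
    (∀ x, |x| ≤ a → σ x = 1) ∧ (∀ x, b ≤ |x| → σ x = 0)

/-- The canonical representative in `[-N/2, N/2) ∩ ℤ` of a residue class modulo `N`.
The discrete torus `[-N/2, N/2) ∩ ℤ` is identified with `ZMod N` in this way. -/
def rep {N : ℕ} (x : ZMod N) : ℤ := (x.val : ℤ).bmod N

/-- The representative lies in `[-N/2, N/2)` and represents the class. -/
theorem rep_spec {N : ℕ} [NeZero N] (x : ZMod N) :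
    -(N : ℤ) ≤ 2 * rep x ∧ 2 * rep x < N ∧ ((rep x : ℤ) : ZMod N) = x := by
  have hN : 0 < N := Nat.pos_of_ne_zero (NeZero.ne N)
  have h1 := Int.le_bmod (x := (x.val : ℤ)) hN
  have h2 := Int.bmod_lt (x := (x.val : ℤ)) hN
  refine ⟨?_, ?_, ?_⟩
  · unfold rep; omega
  · unfold rep; omega
  · have h3 : ((rep x : ℤ) : ZMod N) = ((x.val : ℤ) : ZMod N) := by
      rw [ZMod.intCast_eq_intCast_iff]
      unfold rep
      exact Int.bmod_emod
    rw [h3]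
    simp

/-- The unnormalised weight `f ([x]_N / W) σ ([x]_N / N)`. -/
def weight (f σ : ℝ → ℝ) (N W : ℕ) (x : ZMod N) : ℝ :=
  f ((rep x : ℝ) / W) * σ ((rep x : ℝ) / N)

/-- The normalisation constant `Z`, the common value of the row sums of the weights. -/
def normConst (f σ : ℝ → ℝ) (N W : ℕ) [NeZero N] : ℝ :=
  ∑ x : ZMod N, weight f σ N W x

/-- The band matrix of variances `s_{xy} = Z⁻¹ f ([x - y]_N / W) σ ([x - y]_N / N)`. -/
def bandS (f σ : ℝ → ℝ) (N W : ℕ) [NeZero N] : Matrix (ZMod N) (ZMod N) ℝ :=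
  Matrix.of fun x y => weight f σ N W (x - y) / normConst f σ N W

/-- The Stieltjes transform of the semicircle law. -/
def semicircleStieltjes (z : ℂ) : ℂ :=
  (1 / (2 * Real.pi : ℝ) : ℂ) * ∫ ξ in (-2 : ℝ)..2, ((√(4 - ξ ^ 2) : ℝ) : ℂ) / ((ξ : ℂ) - z)

/-- `|m(z)|²`. -/
def normSqM (z : ℂ) : ℝ := ‖semicircleStieltjes z‖ ^ 2

/-- `Θ = |m|² S (1 - |m|² S)⁻¹`. -/
def profile (f σ : ℝ → ℝ) (N W : ℕ) [NeZero N] (z : ℂ) : Matrix (ZMod N) (ZMod N) ℝ :=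
  (normSqM z • bandS f σ N W) * (1 - normSqM z • bandS f σ N W)⁻¹

/-- `α = 2 / √(4 - E²)`. -/
def alpha (E : ℝ) : ℝ := 2 / √(4 - E ^ 2)

/-- `B = h₀ (W / Z) ∫ (1 - cos u) / |u| ^ (1 + β) du`. -/
def constB (β h₀ : ℝ) (f σ : ℝ → ℝ) (N W : ℕ) [NeZero N] : ℝ :=
  h₀ * (W / normConst f σ N W) * ∫ u : ℝ, (1 - Real.cos u) / |u| ^ (1 + β)

/-- `V(x) = (2π)⁻¹ ∫ exp(i q x) / (1 + |q| ^ β) dq`. -/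
def limitV (β x : ℝ) : ℂ :=
  (1 / (2 * Real.pi : ℝ) : ℂ) *
    ∫ q : ℝ, Complex.exp (Complex.I * q * x) / ((1 + |q| ^ β : ℝ) : ℂ)

end HeavyTailBand

end

/-! `S` is circulant with an even kernel, so `Θ_{x0}` is the average over dual momenta `p` of `cos
(2πpx/N) · ta/(1 - ta)`, with `t = |m|²` and `a` the eigenvalue of `S` at `p` (`circEig`). Put `q =
2πpW/N` (`momentum`). The quadratic equation for `m` gives `1 - t = αη + O(η²)`
(`exists_one_sub_normSqM_bound`). The heavy tail makes `(Z/W)(1 - a)` essentially a Riemann sum for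
`h₀ ∫ (1 - cos qu)/|u|^(1+β) du`, so `1 - a = B|q|^β + O(q² + (W/N)^β)` (`exists_symbol_bounds`).
Hence `ta/(1 - ta)` is close to `t/(αη + B|q|^β)` at small `q`. The lattice average of the latter is
close to an integral (`abs_lattice_sum_sub_integral_le`), which a dilation turns into `V`
(`mul_limitV_eq`).

High momenta are handled by writing `ta/(1 - ta) = ta + (ta)²/(1 - ta)`. The linear part inverts
exactly to `t s_{x0} = O(1/W)`. For `|q| ≥ q₀` there is a uniform gap `1 - a ≥ const`, so the
quadratic part is `O(a²)`, whose average is `∑ s² = O(1/W)` by Parseval; no decay of the Fourier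
transform of `f` is needed.

At low momenta the error is `O(1 + q²/(η + |q|^β)² + ν/(η + |q|^β))`, where `(W/N)^β ≤ νη`
(`abs_resolvent_sub_le`). The middle term is split at the scale `r = η^(1/(2β))`, after which
everything reduces to averages of `1/(r^β + |q|^β)`, of size `r^(1-β)/W`.

Uniformity in `x` is the delicate point of the passage to the integral, since `cos (qx/W)` may
oscillate at the scale of the lattice. Integrating the cosine exactly on each cell and using Abel
summation gives an error free of `x` (`abs_mul_sum_cos_sub_integral_le`). Every error is then `W⁻¹
η^(1/β-1)` times a negative power of `N`, and `N ≥ W` yields `W^(-c)`. -/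

noncomputable section

namespace HeavyTailBand

/-! ### The Stieltjes transform of the semicircle law near the bulk spectrum. -/

section Semicircle

/-- The two roots have product 1, and a root of modulus 1 would force `z = -(w + conj w)` to be
real. So one of them lies inside the unit disc. -/
theorem exists_semicircle_root {z : ℂ} (hz : 0 < z.im) :
    ∃ w : ℂ, w ≠ 0 ∧ ‖w‖ < 1 ∧ w ^ 2 + z * w + 1 = 0 := by
  obtain ⟨s, hs⟩ := IsAlgClosed.exists_pow_nat_eq (z ^ 2 - 4) (n := 2) (by norm_num)
  have hroot : ∀ w : ℂ, w ^ 2 + z * w + 1 = 0 → w ≠ 0 := by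
    rintro w h rfl; simp at h
  have hne : ∀ w : ℂ, w ^ 2 + z * w + 1 = 0 → ‖w‖ ≠ 1 := by
    intro w h h1
    have hw := hroot w h
    have h2 : z = -(w + (starRingEnd ℂ) w) := by
      have h3 : w * (starRingEnd ℂ) w = 1 := by
        rw [Complex.mul_conj, Complex.normSq_eq_norm_sq, h1]; simp
      have : w * (z + (w + (starRingEnd ℂ) w)) = 0 := by linear_combination h + h3
      rcases mul_eq_zero.1 this with h4 | h4
      · exact absurd h4 hw
      · linear_combination h4
    rw [h2] at hz
    simp at hz
  set w₁ := (-z + s) / 2 with hw₁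
  set w₂ := (-z - s) / 2 with hw₂
  have e₁ : w₁ ^ 2 + z * w₁ + 1 = 0 := by rw [hw₁]; linear_combination hs / 4
  have e₂ : w₂ ^ 2 + z * w₂ + 1 = 0 := by rw [hw₂]; linear_combination hs / 4
  have hp : w₁ * w₂ = 1 := by rw [hw₁, hw₂]; linear_combination -hs / 4
  have hn : ‖w₁‖ * ‖w₂‖ = 1 := by rw [← norm_mul, hp, norm_one]
  rcases lt_or_gt_of_ne (hne w₁ e₁) with h | h
  · exact ⟨w₁, hroot _ e₁, h, e₁⟩
  · refine ⟨w₂, hroot _ e₂, ?_, e₂⟩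
    by_contra h2
    push Not at h2
    nlinarith

/-- Polynomial division leaves `(4 - z²)/(2 cos θ - z)`. Since `w (2 cos θ - z) = (1 + w e^{iθ})(1 +
w e^{-iθ})`, partial fractions give an explicit antiderivative. -/
theorem integral_sin_sq_div {z w : ℂ} (hz : 0 < z.im) (hw0 : w ≠ 0) (hw : ‖w‖ < 1)
    (h : w ^ 2 + z * w + 1 = 0) :
    ∫ θ in (0 : ℝ)..Real.pi,
      (4 - (2 * Complex.cos θ) ^ 2) / (2 * Complex.cos θ - z) = 2 * Real.pi * w := by
  have hw2 : 1 - w ^ 2 ≠ 0 := by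
    intro h1
    have h2 : ‖w ^ 2‖ = 1 := by rw [← sub_eq_zero.1 h1, norm_one]
    rw [norm_pow] at h2
    nlinarith [norm_nonneg w]
  have hne : ∀ θ : ℝ, (2 * Complex.cos θ - z) ≠ 0 := by
    intro θ h1
    have := congrArg Complex.im h1
    rw [← Complex.ofReal_cos] at this
    simp at this
    exact hz.ne' this
  set e : ℝ → ℂ := fun θ => Complex.exp (θ * Complex.I) with he
  set e' : ℝ → ℂ := fun θ => Complex.exp (-(θ * Complex.I)) with he'
  have hslit : ∀ u : ℂ, ‖u‖ = 1 → 1 + w * u ∈ Complex.slitPlane := by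
    intro u hu
    refine Complex.mem_slitPlane_of_norm_lt_one ?_
    rw [norm_mul, hu, mul_one]; exact hw
  have hen : ∀ θ, ‖e θ‖ = 1 := fun θ => Complex.norm_exp_ofReal_mul_I θ
  have hen' : ∀ θ, ‖e' θ‖ = 1 := by
    intro θ
    have := Complex.norm_exp_ofReal_mul_I (-θ)
    simpa [he'] using this
  have hee : ∀ θ, e θ * e' θ = 1 := by
    intro θ; simp [he, he', ← Complex.exp_add]
  have hcos : ∀ θ : ℝ, Complex.cos θ = (e θ + e' θ) / 2 := by
    intro θ; rw [Complex.cos, he, he']; simp [neg_mul]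
  have hde : ∀ θ : ℝ, HasDerivAt e (e θ * Complex.I) θ := by
    intro θ
    have h1 : HasDerivAt (fun y : ℝ => (y : ℂ) * Complex.I) (1 * Complex.I) θ :=
      (Complex.ofRealCLM.hasDerivAt (x := θ)).mul_const _
    simpa using h1.cexp
  have hde' : ∀ θ : ℝ, HasDerivAt e' (-(e' θ * Complex.I)) θ := by
    intro θ
    have h1 : HasDerivAt (fun y : ℝ => -((y : ℂ) * Complex.I)) (-(1 * Complex.I)) θ :=
      ((Complex.ofRealCLM.hasDerivAt (x := θ)).mul_const _).neg
    simpa using h1.cexp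
  have hdsin : ∀ θ : ℝ, HasDerivAt (fun y : ℝ => Complex.sin y) (Complex.cos θ) θ := by
    intro θ
    have := (Complex.hasDerivAt_sin θ).comp_ofReal
    simpa using this
  -- Because `‖w‖ < 1`, both arguments stay in the slit plane and the principal logarithm is
  -- differentiable. At `0` and `π` the two exponentials agree, so the logarithms cancel.
  set F : ℝ → ℂ := fun θ => -(2 * Complex.sin θ + z * θ) +
    (4 - z ^ 2) * (w / (1 - w ^ 2) * (θ + Complex.I * Complex.log (1 + w * e θ)
      - Complex.I * Complex.log (1 + w * e' θ))) with hF
  have hd : ∀ θ : ℝ, HasDerivAt F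
      ((4 - (2 * Complex.cos θ) ^ 2) / (2 * Complex.cos θ - z)) θ := by
    intro θ
    have hid : HasDerivAt (fun y : ℝ => (y : ℂ)) 1 θ := Complex.ofRealCLM.hasDerivAt (x := θ)
    have l1 := (((hde θ).const_mul w).const_add 1).clog_real (hslit _ (hen θ))
    have l2 := (((hde' θ).const_mul w).const_add 1).clog_real (hslit _ (hen' θ))
    have h1 := ((((hdsin θ).const_mul 2).add (hid.const_mul z)).neg).add
      ((((hid.add (l1.const_mul Complex.I)).sub (l2.const_mul Complex.I)).const_mul
        (w / (1 - w ^ 2))).const_mul (4 - z ^ 2))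
    refine h1.congr_deriv ?_
    have n1 : 1 + w * e θ ≠ 0 := Complex.slitPlane_ne_zero (hslit _ (hen θ))
    have n2 : 1 + w * e' θ ≠ 0 := Complex.slitPlane_ne_zero (hslit _ (hen' θ))
    have n3 := hne θ
    have hz' : z = -(w + 1 / w) := by field_simp; linear_combination h
    have hfac : (1 + w * e θ) * (1 + w * e' θ) = w * (2 * Complex.cos θ - z) := by
      rw [hcos]; linear_combination w ^ 2 * hee θ + h
    have key : Complex.I * (w * (e θ * Complex.I) / (1 + w * e θ)) =
        1 / (1 + w * e θ) - 1 := by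
      field_simp; rw [Complex.I_sq]; ring
    have key' : Complex.I * (w * -(e' θ * Complex.I) / (1 + w * e' θ)) =
        1 - 1 / (1 + w * e' θ) := by
      field_simp; rw [Complex.I_sq]; ring
    rw [key, key']
    have key2 : w / (1 - w ^ 2) * (1 + (1 / (1 + w * e θ) - 1) - (1 - 1 / (1 + w * e' θ)))
        = 1 / (2 * Complex.cos θ - z) := by
      have : (1 + (1 / (1 + w * e θ) - 1) - (1 - 1 / (1 + w * e' θ)))
        = (1 - w ^ 2) / ((1 + w * e θ) * (1 + w * e' θ)) := by
        field_simp
        linear_combination (-w ^ 2) * hee θ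
      rw [this, hfac]
      field_simp
    rw [key2]
    field_simp
    ring
  have hcont : Continuous fun θ : ℝ =>
      (4 - (2 * Complex.cos θ) ^ 2) / (2 * Complex.cos θ - z) := by
    refine Continuous.div (by fun_prop) (by fun_prop) hne
  rw [intervalIntegral.integral_eq_sub_of_hasDerivAt (fun θ _ => hd θ)
    (hcont.intervalIntegrable _ _)]
  have ep : e Real.pi = -1 := by simp [he]
  have ep' : e' Real.pi = -1 := by simp [he', Complex.exp_neg]
  have e0 : e 0 = 1 := by simp [he]
  have e0' : e' 0 = 1 := by simp [he']
  simp only [hF, ep, ep', e0, e0', Complex.sin_pi, Complex.ofReal_zero, Complex.sin_zero]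
  have hz' : z = -(w + 1 / w) := by field_simp; linear_combination h
  rw [hz']
  field_simp
  ring

theorem semicircleStieltjes_eq {z w : ℂ} (hz : 0 < z.im) (hw0 : w ≠ 0) (hw : ‖w‖ < 1)
    (h : w ^ 2 + z * w + 1 = 0) : semicircleStieltjes z = w := by
  have hsub : ∫ ξ in (-2 : ℝ)..2, ((√(4 - ξ ^ 2) : ℝ) : ℂ) / ((ξ : ℂ) - z)
      = ∫ θ in (0 : ℝ)..Real.pi, (4 - (2 * Complex.cos θ) ^ 2) / (2 * Complex.cos θ - z) := by
    have hc : Continuous fun ξ : ℝ => ((√(4 - ξ ^ 2) : ℝ) : ℂ) / ((ξ : ℂ) - z) := by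
      refine Continuous.div (by fun_prop) (by fun_prop) fun ξ h1 => ?_
      have := congrArg Complex.im h1
      simp at this
      exact hz.ne' this
    have h1 := intervalIntegral.integral_deriv_smul_comp (a := Real.pi) (b := 0)
      (f := fun θ => 2 * Real.cos θ) (f' := fun θ => -(2 * Real.sin θ))
      (g := fun ξ : ℝ => ((√(4 - ξ ^ 2) : ℝ) : ℂ) / ((ξ : ℂ) - z))
      (fun θ _ => by simpa using (Real.hasDerivAt_cos θ).const_mul 2)
      (by fun_prop) hc
    simp only [Real.cos_pi, Real.cos_zero, mul_one, mul_neg, Function.comp_def] at h1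
    rw [← h1, intervalIntegral.integral_symm, ← intervalIntegral.integral_neg]
    refine intervalIntegral.integral_congr fun θ hθ => ?_
    rw [Set.uIcc_of_le Real.pi_pos.le] at hθ
    have hs := Real.sin_nonneg_of_mem_Icc hθ
    have h2 : √(4 - (2 * Real.cos θ) ^ 2) = 2 * Real.sin θ := by
      rw [show 4 - (2 * Real.cos θ) ^ 2 = (2 * Real.sin θ) ^ 2 by
        rw [mul_pow, mul_pow, Real.sin_sq]; ring, Real.sqrt_sq (by positivity)]
    have h3 : (4 - (2 * Complex.cos θ) ^ 2 : ℂ) = (2 * Complex.sin θ) ^ 2 := by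
      rw [mul_pow, mul_pow, Complex.sin_sq]; ring
    simp only [h2, h3, Complex.real_smul]
    push_cast
    ring
  rw [semicircleStieltjes, hsub, integral_sin_sq_div hz hw0 hw h]
  push_cast
  have : (Real.pi : ℂ) ≠ 0 := by exact_mod_cast Real.pi_ne_zero
  field_simp

/-- In the bulk, `1 - |m|² = α η + O(η²)`. -/
theorem exists_one_sub_normSqM_bound {κ : ℝ} (hκ : 0 < κ) :
    ∃ C : ℝ, 0 < C ∧ ∀ E η : ℝ, -2 + κ ≤ E → E ≤ 2 - κ → 0 < η → η ≤ 1 →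
      normSqM (E + η * Complex.I) < 1 ∧
      |1 - normSqM (E + η * Complex.I) - alpha E * η| ≤ C * η ^ 2 ∧
      1 ≤ alpha E ∧ alpha E ≤ C := by
  set r := √(2 * κ) with hr
  have hr0 : 0 < r := Real.sqrt_pos.2 (by positivity)
  refine ⟨2 * ((1 + 4 / r ^ 2) / r + 1) / r ^ 2 + 2 / r, by positivity, fun E η h1 h2 hη hη1 => ?_⟩
  set ρ := √(4 - E ^ 2) with hρ
  have hE : 2 * κ ≤ 4 - E ^ 2 := by nlinarith
  have hρr : r ≤ ρ := Real.sqrt_le_sqrt hE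
  have hρ0 : 0 < ρ := hr0.trans_le hρr
  have hρ2 : ρ ^ 2 = 4 - E ^ 2 := Real.sq_sqrt (by linarith)
  have hρle : ρ ≤ 2 := by nlinarith [sq_nonneg E]
  have hz : 0 < (E + η * Complex.I : ℂ).im := by simpa using hη
  obtain ⟨w, hw0, hw, h⟩ := exists_semicircle_root hz
  have hn : normSqM (E + η * Complex.I) = w.re ^ 2 + w.im ^ 2 := by
    rw [normSqM, semicircleStieltjes_eq hz hw0 hw h, Complex.sq_norm, Complex.normSq_apply]; ring
  have hn1 : w.re ^ 2 + w.im ^ 2 < 1 := by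
    have : ‖w‖ ^ 2 < 1 := by nlinarith [norm_nonneg w]
    rwa [Complex.sq_norm, Complex.normSq_apply, ← sq, ← sq] at this
  have hre := congrArg Complex.re h
  have him := congrArg Complex.im h
  simp [pow_two] at hre him
  rw [hn]
  set x := w.re
  set y := w.im
  have hn0 : 0 < x ^ 2 + y ^ 2 := by
    have : x ≠ 0 ∨ y ≠ 0 := by
      by_contra hc
      push Not at hc
      exact hw0 (Complex.ext hc.1 hc.2)
    rcases this with h | h <;> positivity
  -- The imaginary part of `w + 1/w = -z`, cleared of denominators.
  have hy : y * (1 - (x ^ 2 + y ^ 2)) = η * (x ^ 2 + y ^ 2) := by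
    linear_combination y * hre - x * him
  have hy0 : 0 < y := by
    by_contra hc
    push Not at hc
    nlinarith [mul_pos hη hn0]
  -- `a + ib = 2w + z` is a square root of `z² - 4`, so `b` is `√(4 - E²)` up to `O(η)`; and `1 -
  -- |w|² = 2η/(b + η)`.
  set a := 2 * x + E with ha
  set b := 2 * y + η with hb
  have hb0 : 0 < b := by positivity
  have hab : a ^ 2 - b ^ 2 = E ^ 2 - 4 - η ^ 2 := by rw [ha, hb]; linear_combination 4 * hre
  have hab2 : a * b = E * η := by rw [ha, hb]; linear_combination 2 * him
  have hbρ : ρ ≤ b := by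
    refine (pow_le_pow_iff_left₀ hρ0.le hb0.le two_ne_zero).1 ?_
    linarith [sq_nonneg a, sq_nonneg η]
  have ha2 : a ^ 2 ≤ 4 / r ^ 2 * η ^ 2 := by
    have e1 : a ^ 2 * r ^ 2 ≤ a ^ 2 * b ^ 2 := by gcongr; linarith
    have e2 : a ^ 2 * b ^ 2 ≤ 4 * η ^ 2 := by
      rw [← mul_pow, hab2, mul_pow]; gcongr; linarith [sq_nonneg ρ]
    rw [div_mul_eq_mul_div, le_div_iff₀ (by positivity)]
    linarith
  have hbu : b - ρ ≤ (1 + 4 / r ^ 2) / r * η := by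
    have e1 : (b - ρ) * r ≤ (b - ρ) * (b + ρ) :=
      mul_le_mul_of_nonneg_left (by linarith) (by linarith)
    have e2 : (b - ρ) * (b + ρ) = a ^ 2 + η ^ 2 := by linear_combination -hab - hρ2
    have e3 : (b - ρ) * r ≤ (1 + 4 / r ^ 2) * η := by
      have : η ^ 2 ≤ η := by nlinarith
      have : (1 + 4 / r ^ 2) * η ^ 2 ≤ (1 + 4 / r ^ 2) * η := by gcongr
      linarith
    rw [div_mul_eq_mul_div, le_div_iff₀ hr0]
    exact e3
  have hα : alpha E = 2 / ρ := rfl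
  refine ⟨hn1, ?_, ?_, ?_⟩
  · have e1 : 1 - (x ^ 2 + y ^ 2) - alpha E * η = -(2 * η * (b + η - ρ) / (ρ * (b + η))) := by
      have : 1 - (x ^ 2 + y ^ 2) = 2 * η / (b + η) := by
        rw [eq_div_iff (by positivity), hb]; linear_combination 2 * hy
      rw [this, hα]
      have : b + η ≠ 0 := by positivity
      field_simp
      ring
    have e2 : 0 ≤ b + η - ρ := by linarith
    rw [e1, abs_neg, abs_of_nonneg (by positivity)]
    have e3 : 2 * η * (b + η - ρ) / (ρ * (b + η)) ≤
        2 * η * (((1 + 4 / r ^ 2) / r + 1) * η) / (r * r) := by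
      gcongr <;> linarith
    refine e3.trans ?_
    have : 0 ≤ 2 / r * η ^ 2 := by positivity
    have e4 : 2 * η * (((1 + 4 / r ^ 2) / r + 1) * η) / (r * r)
      = 2 * ((1 + 4 / r ^ 2) / r + 1) / r ^ 2 * η ^ 2 := by ring
    rw [e4, add_mul]; linarith
  · rw [hα, le_div_iff₀ hρ0]; linarith
  · rw [hα]
    have : 2 / ρ ≤ 2 / r := by gcongr
    have : 0 ≤ 2 * ((1 + 4 / r ^ 2) / r + 1) / r ^ 2 := by positivity
    linarith

end Semicircle

/-! ### Fourier analysis of even circulant matrices on the discrete torus. -/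

section Circulant

variable {N : ℕ} [NeZero N]

/-- The real character `cos (2π p w / N)` of the discrete torus. -/
def circCos (p w : ZMod N) : ℝ := (ZMod.stdAddChar (p * w) : ℂ).re

theorem circCos_eq (p w : ZMod N) :
    circCos p w = Real.cos (2 * Real.pi * rep p / N * rep w) := by
  have h : p * w = ((rep p * rep w : ℤ) : ZMod N) := by
    push_cast
    rw [(rep_spec p).2.2, (rep_spec w).2.2]
  have h2 : (2 * Real.pi * Complex.I * ((rep p * rep w : ℤ) : ℂ) / N : ℂ)
      = ((2 * Real.pi * rep p / N * rep w : ℝ) : ℂ) * Complex.I := by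
    push_cast; ring
  rw [circCos, h, ZMod.stdAddChar_coe, h2, Complex.exp_ofReal_mul_I_re]

theorem abs_circCos_le_one (p w : ZMod N) : |circCos p w| ≤ 1 := by
  rw [circCos_eq]; exact Real.abs_cos_le_one _

theorem circCos_sub_add_circCos_add (p w u : ZMod N) :
    circCos p (w - u) + circCos p (w + u) = 2 * circCos p w * circCos p u := by
  have h : p * (w - u) = p * w + -(p * u) := by ring
  have hs : ∀ a : ZMod N, (ZMod.stdAddChar (-a) : ℂ) = (starRingEnd ℂ) (ZMod.stdAddChar a) :=
    fun a => AddChar.map_neg_eq_conj _ _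
  simp only [circCos, h, mul_add, AddChar.map_add_eq_mul, hs, Complex.mul_re, Complex.conj_re,
    Complex.conj_im]
  ring

theorem sum_circCos (w : ZMod N) :
    ∑ p : ZMod N, circCos p w = if w = 0 then (N : ℝ) else 0 := by
  have h := AddChar.sum_mulShift (R' := ℂ) w (ZMod.isPrimitive_stdAddChar N)
  have h2 := congrArg Complex.re h
  rw [Complex.re_sum] at h2
  simp only [circCos]
  rw [h2, ZMod.card]
  split_ifs <;> simp

/-- The eigenvalue at frequency `p` of the circulant matrix with even symbol `v`. -/
def circEig (v : ZMod N → ℝ) (p : ZMod N) : ℝ := ∑ u, v u * circCos p u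

/-- Evenness of `v` allows averaging over `u` and `-u`, and the product formula for cosines then
replaces multiplicativity of characters. -/
theorem sum_mul_circCos_sub {v : ZMod N → ℝ} (hv : ∀ u, v (-u) = v u) (p w : ZMod N) :
    ∑ u, v u * circCos p (w - u) = circEig v p * circCos p w := by
  have h1 : ∑ u, v u * circCos p (w - u) = ∑ u, v u * circCos p (w + u) := by
    rw [← Equiv.sum_comp (Equiv.neg (ZMod N))]
    simp [hv]
  have h2 : ∑ u, v u * circCos p (w - u) + ∑ u, v u * circCos p (w + u)
      = 2 * (circEig v p * circCos p w) := by
    rw [← Finset.sum_add_distrib, circEig, Finset.sum_mul, Finset.mul_sum]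
    refine Finset.sum_congr rfl fun u _ => ?_
    rw [← mul_add, circCos_sub_add_circCos_add]; ring
  linarith

theorem sum_circEig_mul_circCos {v : ZMod N → ℝ} (hv : ∀ u, v (-u) = v u) (w : ZMod N) :
    ∑ p, circEig v p * circCos p w = N * v w := by
  simp_rw [← sum_mul_circCos_sub hv]
  rw [Finset.sum_comm]
  simp_rw [← Finset.mul_sum, sum_circCos, sub_eq_zero]
  simp [mul_comm]

/-- Parseval's identity, which controls the high momenta. -/
theorem sum_sq_circEig {v : ZMod N → ℝ} (hv : ∀ u, v (-u) = v u) :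
    ∑ p, circEig v p ^ 2 = N * ∑ u, v u ^ 2 := by
  have : ∀ p, circEig v p ^ 2 = ∑ u, v u * (circEig v p * circCos p u) := by
    intro p
    rw [sq]
    nth_rewrite 1 [circEig]
    rw [Finset.sum_mul]
    exact Finset.sum_congr rfl fun u _ => by ring
  simp_rw [this]
  rw [Finset.sum_comm]
  simp_rw [← Finset.mul_sum, sum_circEig_mul_circCos hv]
  rw [Finset.mul_sum]
  exact Finset.sum_congr rfl fun u _ => by ring

theorem abs_circEig_le {v : ZMod N → ℝ} (hv : ∀ u, 0 ≤ v u) (p : ZMod N) :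
    |circEig v p| ≤ ∑ u, v u := by
  refine (Finset.abs_sum_le_sum_abs _ _).trans (Finset.sum_le_sum fun u _ => ?_)
  rw [abs_mul, abs_of_nonneg (hv u)]
  exact mul_le_of_le_one_right (hv u) (abs_circCos_le_one _ _)

theorem one_sub_smul_circulant_mul {v : ZMod N → ℝ} (hv : ∀ u, v (-u) = v u) {t : ℝ}
    (ht : ∀ p, 1 - t * circEig v p ≠ 0) :
    (1 - t • Matrix.of fun x y => v (x - y)) *
      (Matrix.of fun x y : ZMod N => (∑ p, circCos p (x - y) / (1 - t * circEig v p)) / N) = 1 := by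
  have hN : (N : ℝ) ≠ 0 := Nat.cast_ne_zero.2 (NeZero.ne N)
  ext x z
  rw [sub_mul, one_mul, smul_mul_assoc, Matrix.sub_apply, Matrix.smul_apply, Matrix.mul_apply]
  simp only [Matrix.of_apply, smul_eq_mul]
  have h1 : ∑ y, v (x - y) * ((∑ p, circCos p (y - z) / (1 - t * circEig v p)) / N)
      = (∑ p, circEig v p * circCos p (x - z) / (1 - t * circEig v p)) / N := by
    rw [← Equiv.sum_comp (Equiv.subLeft x)]
    simp only [Equiv.subLeft_apply, sub_sub_cancel]
    simp_rw [mul_div_assoc', Finset.mul_sum]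
    rw [← Finset.sum_div, Finset.sum_comm]
    congr 1
    refine Finset.sum_congr rfl fun p _ => ?_
    rw [← sum_mul_circCos_sub hv, Finset.sum_div]
    refine Finset.sum_congr rfl fun u _ => ?_
    rw [show x - u - z = x - z - u by ring]; ring
  rw [h1, mul_div_assoc', ← sub_div, Finset.mul_sum, ← Finset.sum_sub_distrib]
  have h2 : ∀ p, circCos p (x - z) / (1 - t * circEig v p)
      - t * (circEig v p * circCos p (x - z) / (1 - t * circEig v p)) = circCos p (x - z) := by
    intro p
    have := ht p
    field_simp
  simp_rw [h2]
  rw [sum_circCos, Matrix.one_apply]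
  simp only [sub_eq_zero]
  split_ifs <;> simp [hN]

/-- With `a = circEig v p`, the splitting `ta/(1 - ta) = ta + (ta)²/(1 - ta)`: the linear part is
inverted exactly, and the remaining multiplier is quadratic in `a`, hence within reach of Parseval.
-/
theorem smul_circulant_mul_inv_apply {v : ZMod N → ℝ} (hv : ∀ u, v (-u) = v u) {t : ℝ}
    (ht : ∀ p, 1 - t * circEig v p ≠ 0) (x : ZMod N) :
    ((t • Matrix.of fun x y => v (x - y)) * (1 - t • Matrix.of fun x y => v (x - y))⁻¹) x 0 =
      t * v x + (∑ p, circCos p x * ((t * circEig v p) ^ 2 / (1 - t * circEig v p))) / N := by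
  have hN : (N : ℝ) ≠ 0 := Nat.cast_ne_zero.2 (NeZero.ne N)
  rw [Matrix.inv_eq_right_inv (one_sub_smul_circulant_mul hv ht)]
  have h0 := one_sub_smul_circulant_mul hv ht
  rw [sub_mul, one_mul, sub_eq_iff_eq_add] at h0
  have h3 : ∀ A B : Matrix (ZMod N) (ZMod N) ℝ, A = 1 + B → B = A - 1 := by
    rintro A B rfl; abel
  rw [h3 _ _ h0, Matrix.sub_apply, Matrix.of_apply, Matrix.one_apply, sub_zero]
  have h4 : (if x = 0 then (1 : ℝ) else 0) = (∑ p, circCos p x) / N := by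
    rw [sum_circCos]; split_ifs <;> simp [hN]
  have h5 : v x = (∑ p, circEig v p * circCos p x) / N := by
    rw [sum_circEig_mul_circCos hv]; field_simp
  rw [h4, h5, ← sub_div, mul_div_assoc', ← add_div, Finset.mul_sum, ← Finset.sum_sub_distrib,
    ← Finset.sum_add_distrib]
  congr 1
  refine Finset.sum_congr rfl fun p _ => ?_
  have := ht p
  field_simp
  ring

/-- A sum over the torus of an even function of the representative. -/
theorem sum_rep_eq (F : ℤ → ℝ) (hF : ∀ j, F (-j) = F j) :
    ∑ p : ZMod N, F (rep p) = F 0 + ∑ j ∈ Finset.Icc 1 ((N - 1) / 2), F (j : ℕ)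
      + ∑ j ∈ Finset.Icc 1 (N / 2), F (j : ℕ) := by
  have hN : 0 < N := Nat.pos_of_ne_zero (NeZero.ne N)
  -- For even `N` the point `-N/2` has no mirror image, so the negative side may be one term longer.
  have h1 : ∑ p : ZMod N, F (rep p) = ∑ j ∈ Finset.Icc (-(N / 2 : ℕ) : ℤ) ((N - 1) / 2 : ℕ), F j := by
    refine Finset.sum_bij' (fun p _ => rep p) (fun j _ => (j : ZMod N)) ?_ ?_ ?_ ?_ ?_
    · intro p _
      obtain ⟨h1, h2, -⟩ := rep_spec p
      rw [Finset.mem_Icc]; omega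
    · intros; exact Finset.mem_univ _
    · intro p _; exact (rep_spec p).2.2
    · intro j hj
      rw [Finset.mem_Icc] at hj
      obtain ⟨h1, h2, h3⟩ := rep_spec (j : ZMod N)
      rw [ZMod.intCast_eq_intCast_iff] at h3
      have h4 := (Int.modEq_iff_dvd.1 h3)
      obtain ⟨k, hk⟩ := h4
      have : k = 0 := by
        by_contra hk0
        rcases lt_or_gt_of_ne hk0 with h | h
        · have : (N : ℤ) * k ≤ -N := by nlinarith
          omega
        · have : (N : ℤ) ≤ N * k := by nlinarith
          omega
      subst this; omega
    · intros; rfl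
  have h2 : ∀ (a b : ℕ), ∑ j ∈ Finset.Icc (-(b : ℕ) : ℤ) (a : ℕ), F j
      = F 0 + ∑ j ∈ Finset.Icc 1 a, F (j : ℕ) + ∑ j ∈ Finset.Icc 1 b, F (j : ℕ) := by
    intro a b
    induction a with
    | zero =>
      induction b with
      | zero => simp
      | succ b ih =>
        rw [Finset.sum_Icc_succ_top (by omega), ← add_assoc, ← ih]
        have : Finset.Icc (-((b + 1 : ℕ) : ℤ)) ((0 : ℕ) : ℤ)
            = insert (-((b + 1 : ℕ) : ℤ)) (Finset.Icc (-(b : ℤ)) ((0 : ℕ) : ℤ)) := by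
          ext j; simp only [Finset.mem_insert, Finset.mem_Icc]; omega
        rw [this, Finset.sum_insert (by simp), hF]; ring
    | succ a ih =>
      rw [Finset.sum_Icc_succ_top (by omega)]
      have : Finset.Icc (-(b : ℤ)) ((a + 1 : ℕ) : ℤ)
          = insert ((a + 1 : ℕ) : ℤ) (Finset.Icc (-(b : ℤ)) (a : ℤ)) := by
        ext j; simp only [Finset.mem_insert, Finset.mem_Icc]; omega
      rw [this, Finset.sum_insert (by simp), ih]; ring
  rw [h1, h2]

end Circulant

/-! ### Riemann sums of monotone and oscillating functions. -/

section RiemannSums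

/-- Only right endpoints are sampled, so monotonicity on the open half-line is enough. This admits
integrands with a singularity at `0`, such as `y^(1-β)`. -/
theorem mul_sum_le_integral_Ioi {F : ℝ → ℝ} (hF : AntitoneOn F (Set.Ioi 0))
    (h0 : ∀ x, 0 < x → 0 ≤ F x) (hi : IntegrableOn F (Set.Ioi 0)) {Δ : ℝ} (hΔ : 0 < Δ) (n : ℕ) :
    Δ * ∑ j ∈ Finset.Icc 1 n, F (j * Δ) ≤ ∫ x in Set.Ioi 0, F x := by
  have h1 : Δ * ∑ j ∈ Finset.Icc 1 n, F (j * Δ) ≤ ∫ x in Set.Ioc 0 (n * Δ), F x := by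
    induction n with
    | zero => simp
    | succ n ih =>
      have hle : (n : ℝ) * Δ ≤ (n + 1 : ℕ) * Δ := by gcongr; simp
      have hn0 : 0 ≤ (n : ℝ) * Δ := by positivity
      rw [Finset.sum_Icc_succ_top (by omega), mul_add, ← Set.Ioc_union_Ioc_eq_Ioc hn0 hle,
        setIntegral_union (Set.Ioc_disjoint_Ioc_of_le le_rfl) measurableSet_Ioc
          (hi.mono_set Set.Ioc_subset_Ioi_self)
          (hi.mono_set fun x hx => lt_of_le_of_lt hn0 hx.1)]
      refine add_le_add ih ?_
      have h2 : ∫ _ in Set.Ioc (n * Δ) ((n + 1 : ℕ) * Δ), F ((n + 1 : ℕ) * Δ)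
          ≤ ∫ x in Set.Ioc (n * Δ) ((n + 1 : ℕ) * Δ), F x := by
        refine setIntegral_mono_on (by simp) (hi.mono_set fun x hx => lt_of_le_of_lt hn0 hx.1)
          measurableSet_Ioc fun x hx => hF (lt_of_le_of_lt hn0 hx.1) ?_ hx.2
        simp only [Set.mem_Ioi]; positivity
      refine le_trans (le_of_eq ?_) h2
      rw [setIntegral_const, Measure.real, Real.volume_Ioc, smul_eq_mul,
        ENNReal.toReal_ofReal (by linarith)]
      push_cast; ring
  refine h1.trans (setIntegral_mono_set hi ?_ (Filter.Eventually.of_forall fun x hx => hx.1))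
  filter_upwards [ae_restrict_mem measurableSet_Ioi] with x hx using h0 x hx

theorem integral_cos_mul_cell (c Δ X : ℝ) :
    ∫ q in (c - Δ / 2)..(c + Δ / 2), Real.cos (q * X)
      = Δ * Real.sinc (Δ * X / 2) * Real.cos (c * X) := by
  rcases eq_or_ne X 0 with rfl | hX
  · simp
  rcases eq_or_ne Δ 0 with rfl | hΔ
  · simp
  rw [intervalIntegral.integral_comp_mul_right _ hX, integral_cos,
    Real.sinc_of_ne_zero (by positivity), Real.sin_sub_sin]
  rw [show ((c + Δ / 2) * X - (c - Δ / 2) * X) / 2 = Δ * X / 2 by ring,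
    show ((c + Δ / 2) * X + (c - Δ / 2) * X) / 2 = c * X by ring]
  simp only [smul_eq_mul]
  field_simp

/-- On each cell centred at `jΔ` only the amplitude is frozen; the cosine is integrated exactly and
produces the factor `sinc`. The cost is the oscillation of `g`, which telescopes, so the bound is
independent of `X`. -/
theorem abs_integral_sub_sinc_mul_sum_le {g : ℝ → ℝ} (hg : Continuous g)
    (ha : AntitoneOn g (Set.Ici 0)) {Δ : ℝ} (hΔ : 0 < Δ) (X : ℝ) (n : ℕ) :
    |(∫ q in (Δ / 2)..((n + 1 / 2) * Δ), g q * Real.cos (q * X)) -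
      Real.sinc (Δ * X / 2) * (Δ * ∑ j ∈ Finset.Icc 1 n, g (j * Δ) * Real.cos (j * Δ * X))|
      ≤ Δ * (g (Δ / 2) - g ((n + 1 / 2) * Δ)) := by
  have hii : ∀ a b, IntervalIntegrable (fun q => g q * Real.cos (q * X)) volume a b :=
    fun a b => (by fun_prop : Continuous fun q => g q * Real.cos (q * X)).intervalIntegrable a b
  induction n with
  | zero =>
    rw [show (((0 : ℕ) : ℝ) + 1 / 2) * Δ = Δ / 2 by push_cast; ring]; simp
  | succ n ih =>
    set c : ℝ := (n + 1 : ℕ) * Δ with hc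
    have hc0 : 0 < c := by positivity
    have hca : ((n : ℝ) + 1 / 2) * Δ = c - Δ / 2 := by rw [hc]; push_cast; ring
    have hcb : (((n + 1 : ℕ) : ℝ) + 1 / 2) * Δ = c + Δ / 2 := by rw [hc]; push_cast; ring
    have hc2 : 0 ≤ c - Δ / 2 := by rw [← hca]; positivity
    rw [Finset.sum_Icc_succ_top (by omega), hcb,
      ← intervalIntegral.integral_add_adjacent_intervals (hii _ (c - Δ / 2)) (hii _ _)]
    rw [hca] at ih
    have h1 : |(∫ q in (c - Δ / 2)..(c + Δ / 2), g q * Real.cos (q * X)) -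
        Real.sinc (Δ * X / 2) * (Δ * (g c * Real.cos (c * X)))|
        ≤ Δ * (g (c - Δ / 2) - g (c + Δ / 2)) := by
      have e1 : Real.sinc (Δ * X / 2) * (Δ * (g c * Real.cos (c * X)))
          = ∫ q in (c - Δ / 2)..(c + Δ / 2), g c * Real.cos (q * X) := by
        rw [intervalIntegral.integral_const_mul, integral_cos_mul_cell]; ring
      rw [e1, ← intervalIntegral.integral_sub (hii _ _)
        ((by fun_prop : Continuous fun q => g c * Real.cos (q * X)).intervalIntegrable _ _)]
      have h2 := intervalIntegral.norm_integral_le_of_norm_le_const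
        (a := c - Δ / 2) (b := c + Δ / 2) (C := g (c - Δ / 2) - g (c + Δ / 2))
        (f := fun q => g q * Real.cos (q * X) - g c * Real.cos (q * X)) ?_
      · rw [Real.norm_eq_abs] at h2
        refine h2.trans (le_of_eq ?_)
        rw [show c + Δ / 2 - (c - Δ / 2) = Δ by ring, abs_of_pos hΔ]; ring
      · intro q hq
        rw [Set.uIoc_of_le (by linarith)] at hq
        have q1 : g q ≤ g (c - Δ / 2) := ha hc2 (hc2.trans hq.1.le) hq.1.le
        have q2 : g (c + Δ / 2) ≤ g q := ha (hc2.trans hq.1.le) (by simp; linarith) hq.2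
        have q3 : g c ≤ g (c - Δ / 2) := ha hc2 hc0.le (by linarith)
        have q4 : g (c + Δ / 2) ≤ g c := ha hc0.le (by simp; linarith) (by linarith)
        rw [Real.norm_eq_abs, ← sub_mul, abs_mul]
        refine (mul_le_of_le_one_right (abs_nonneg _) (Real.abs_cos_le_one _)).trans ?_
        rw [abs_le]; constructor <;> linarith
    rw [mul_add, mul_add]
    calc _ = |((∫ q in (Δ / 2)..(c - Δ / 2), g q * Real.cos (q * X)) -
      Real.sinc (Δ * X / 2) * (Δ * ∑ j ∈ Finset.Icc 1 n, g (j * Δ) * Real.cos (j * Δ * X))) +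
        ((∫ q in (c - Δ / 2)..(c + Δ / 2), g q * Real.cos (q * X)) -
        Real.sinc (Δ * X / 2) * (Δ * (g c * Real.cos (c * X))))| := by congr 1; ring
      _ ≤ _ := abs_add_le _ _
      _ ≤ Δ * (g (Δ / 2) - g (c - Δ / 2)) + Δ * (g (c - Δ / 2) - g (c + Δ / 2)) :=
        add_le_add ih h1
      _ = _ := by ring

/-- Abel summation: `2 sin (θ/2) cos (jθ)` is a difference of consecutive sines, and the increments
of `a` telescope. -/
theorem abs_two_sin_mul_sum_cos_le {a : ℕ → ℝ} (ha : Antitone a) (h0 : ∀ n, 0 ≤ a n) (θ : ℝ)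
    (n : ℕ) : |2 * Real.sin (θ / 2) * ∑ j ∈ Finset.Icc 1 n, a j * Real.cos (j * θ)| ≤ 2 * a 0 := by
  have h1 : |2 * Real.sin (θ / 2) * ∑ j ∈ Finset.Icc 1 n, a j * Real.cos (j * θ)
      - a n * Real.sin ((n + 1 / 2) * θ)| ≤ 2 * a 0 - a n := by
    induction n with
    | zero =>
      have : |a 0 * Real.sin ((0 + 1 / 2) * θ)| ≤ a 0 := by
        rw [abs_mul, abs_of_nonneg (h0 0)]
        exact mul_le_of_le_one_right (h0 0) (Real.abs_sin_le_one _)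
      simp only [Nat.cast_zero]
      rw [show Finset.Icc 1 0 = (∅ : Finset ℕ) by simp, Finset.sum_empty, mul_zero, zero_sub,
        abs_neg]
      linarith
    | succ n ih =>
      rw [Finset.sum_Icc_succ_top (by omega)]
      have e1 : 2 * Real.sin (θ / 2) * Real.cos ((n + 1 : ℕ) * θ)
          = Real.sin (((n + 1 : ℕ) + 1 / 2) * θ) - Real.sin ((n + 1 / 2) * θ) := by
        rw [Real.sin_sub_sin]
        push_cast
        congr 2 <;> ring_nf
      have e2 : |(a n - a (n + 1)) * Real.sin ((n + 1 / 2) * θ)| ≤ a n - a (n + 1) := by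
        have : 0 ≤ a n - a (n + 1) := sub_nonneg.2 (ha (Nat.le_succ n))
        rw [abs_mul, abs_of_nonneg this]
        exact mul_le_of_le_one_right this (Real.abs_sin_le_one _)
      calc _ = |(2 * Real.sin (θ / 2) * ∑ j ∈ Finset.Icc 1 n, a j * Real.cos (j * θ)
      - a n * Real.sin ((n + 1 / 2) * θ)) + (a n - a (n + 1)) * Real.sin ((n + 1 / 2) * θ)| := by
            congr 1; linear_combination a (n + 1) * e1
        _ ≤ _ := abs_add_le _ _
        _ ≤ _ := by linarith
  have h2 : |a n * Real.sin ((n + 1 / 2) * θ)| ≤ a n := by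
    rw [abs_mul, abs_of_nonneg (h0 n)]
    exact mul_le_of_le_one_right (h0 n) (Real.abs_sin_le_one _)
  rw [abs_le] at h1 h2 ⊢
  constructor <;> linarith

theorem one_half_le_sinc {φ : ℝ} (h : |φ| ≤ Real.pi / 2) : 1 / 2 ≤ Real.sinc φ := by
  wlog h0 : 0 < φ generalizing φ
  · rcases (not_lt.1 h0).eq_or_lt with rfl | h1
    · norm_num
    · rw [← Real.sinc_neg]
      exact this (by rwa [abs_neg]) (by linarith)
  rw [abs_of_pos h0] at h
  rw [Real.sinc_of_ne_zero h0.ne', le_div_iff₀ h0]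
  have h1 := Real.mul_le_sin h0.le h
  refine le_trans ?_ h1
  refine mul_le_mul_of_nonneg_right ?_ h0.le
  rw [div_le_div_iff₀ (by norm_num) Real.pi_pos]
  linarith [Real.pi_le_four]

theorem one_sub_sinc_le {φ : ℝ} (h : |φ| ≤ Real.pi / 2) : 1 - Real.sinc φ ≤ |φ| := by
  wlog h0 : 0 < φ generalizing φ
  · rcases (not_lt.1 h0).eq_or_lt with rfl | h1
    · norm_num
    · rw [← Real.sinc_neg, ← abs_neg]
      exact this (by rwa [abs_neg]) (by linarith)
  rw [abs_of_pos h0] at h ⊢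
  have h2 := one_half_le_sinc (φ := φ) (by rwa [abs_of_pos h0])
  rcases le_or_gt φ 1 with h1 | h1
  · have h3 := Real.sin_gt_sub_cube h0
    rw [Real.sinc_of_ne_zero h0.ne', sub_le_comm, le_div_iff₀ h0]
    nlinarith [mul_pos h0 h0]
  · linarith

/-- The Riemann sum of an oscillating integral with antitone amplitude, uniformly in the
frequency `X` up to the Nyquist frequency. -/
theorem abs_mul_sum_cos_sub_integral_le {g : ℝ → ℝ} (hg : Continuous g)
    (ha : AntitoneOn g (Set.Ici 0)) (h0 : ∀ x, 0 ≤ g x) (hi : IntegrableOn g (Set.Ioi 0))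
    {Δ : ℝ} (hΔ : 0 < Δ) {X : ℝ} (hX : |Δ * X| ≤ Real.pi) (n : ℕ) :
    |Δ * ∑ j ∈ Finset.Icc 1 n, g (j * Δ) * Real.cos (j * Δ * X) -
      ∫ q in Set.Ioi 0, g q * Real.cos (q * X)| ≤ 4 * Δ * g 0 + ∫ q in Set.Ioi (n * Δ), g q := by
  have hcc : Continuous fun q => g q * Real.cos (q * X) := by fun_prop
  have hgi : IntegrableOn (fun q => g q * Real.cos (q * X)) (Set.Ioi 0) := by
    refine Integrable.mono hi hcc.aestronglyMeasurable (Filter.Eventually.of_forall fun q => ?_)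
    rw [norm_mul]
    exact mul_le_of_le_one_right (norm_nonneg _) (Real.abs_cos_le_one _)
  set c : ℝ := (n + 1 / 2) * Δ with hc
  have hnc : n * Δ ≤ c := by rw [hc]; nlinarith
  have hn0 : 0 ≤ n * Δ := by positivity
  have hc0 : 0 ≤ c := by positivity
  set S := ∑ j ∈ Finset.Icc 1 n, g (j * Δ) * Real.cos (j * Δ * X) with hS
  have hgm : g (Δ / 2) ≤ g 0 := ha (by simp) (by simp; positivity) (by positivity)
  have hcell := abs_integral_sub_sinc_mul_sum_le hg ha hΔ X n
  rw [← hc, ← hS] at hcell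
  have hφ : |Δ * X / 2| ≤ Real.pi / 2 := by rw [abs_div, abs_two]; gcongr
  have habel : |2 * Real.sin (Δ * X / 2) * S| ≤ 2 * g 0 := by
    have := abs_two_sin_mul_sum_cos_le (a := fun j => g (j * Δ))
      (fun i j hij => ha (by simp; positivity) (by simp; positivity) (by gcongr))
      (fun n => h0 _) (Δ * X) n
    simpa [hS, mul_assoc] using this
  have hsin : Real.sin (Δ * X / 2) = Real.sinc (Δ * X / 2) * (Δ * X / 2) := by
    rcases eq_or_ne (Δ * X / 2) 0 with h | h
    · simp [h]
    · rw [Real.sinc_of_ne_zero h, div_mul_cancel₀ _ h]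
  have h1 := one_half_le_sinc hφ
  have h2 := one_sub_sinc_le hφ
  -- Removing the factor `sinc φ`, `φ = ΔX/2`: since `1 - sinc φ ≤ |φ|` and `sinc φ ≥ 1/2`, the
  -- defect is at most `|2 sin φ|`, which Abel summation controls. This needs `|φ| ≤ π/2`.
  have h3 : |(1 - Real.sinc (Δ * X / 2)) * S| ≤ 2 * g 0 := by
    rw [abs_mul, abs_of_nonneg (sub_nonneg.2 (Real.sinc_le_one (Δ * X / 2)))]
    refine le_trans ?_ habel
    rw [abs_mul, abs_mul, abs_two, hsin, abs_mul,
      abs_of_nonneg (by linarith : 0 ≤ Real.sinc (Δ * X / 2))]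
    refine mul_le_mul_of_nonneg_right ?_ (abs_nonneg _)
    nlinarith [abs_nonneg (Δ * X / 2)]
  have h4 : |∫ q in (0 : ℝ)..(Δ / 2), g q * Real.cos (q * X)| ≤ Δ / 2 * g 0 := by
    have := intervalIntegral.norm_integral_le_of_norm_le_const (a := 0) (b := Δ / 2) (C := g 0)
      (f := fun q => g q * Real.cos (q * X)) ?_
    · rw [Real.norm_eq_abs, sub_zero, abs_of_pos (by positivity : 0 < Δ / 2)] at this
      linarith
    · intro q hq
      rw [Set.uIoc_of_le (by positivity)] at hq
      rw [norm_mul, Real.norm_of_nonneg (h0 q)]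
      exact (mul_le_of_le_one_right (h0 q) (Real.abs_cos_le_one _)).trans
        (ha (by simp) hq.1.le hq.1.le)
  have h5 : |∫ q in Set.Ioi c, g q * Real.cos (q * X)| ≤ ∫ q in Set.Ioi (n * Δ), g q := by
    refine (norm_integral_le_of_norm_le (g := g) (f := fun q => g q * Real.cos (q * X))
      (hi.mono_set (Set.Ioi_subset_Ioi hc0))
      (Filter.Eventually.of_forall fun q => ?_)).trans ?_
    · rw [norm_mul, Real.norm_of_nonneg (h0 q)]
      exact mul_le_of_le_one_right (h0 q) (Real.abs_cos_le_one _)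
    · exact setIntegral_mono_set (hi.mono_set (Set.Ioi_subset_Ioi hn0))
        (Filter.Eventually.of_forall fun q => h0 q)
        (Filter.Eventually.of_forall fun q hq => lt_of_le_of_lt hnc hq)
  have h6 : ∫ q in Set.Ioi 0, g q * Real.cos (q * X) =
      (∫ q in (0 : ℝ)..(Δ / 2), g q * Real.cos (q * X)) +
      (∫ q in (Δ / 2)..c, g q * Real.cos (q * X)) + ∫ q in Set.Ioi c, g q * Real.cos (q * X) := by
    rw [intervalIntegral.integral_add_adjacent_intervals (hcc.intervalIntegrable _ _)
      (hcc.intervalIntegrable _ _), intervalIntegral.integral_interval_add_Ioi hgi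
        (hgi.mono_set (Set.Ioi_subset_Ioi hc0))]
  have h7 : |Δ * ((1 - Real.sinc (Δ * X / 2)) * S)| ≤ Δ * (2 * g 0) := by
    rw [abs_mul, abs_of_pos hΔ]; gcongr
  have h8 := h0 c
  have h9 : Δ * (g (Δ / 2) - g c) ≤ Δ * g 0 := by gcongr; linarith
  have h10 : 0 ≤ Δ * g 0 := mul_nonneg hΔ.le (h0 0)
  rw [h6, abs_le]
  rw [abs_le] at h4 h5 h7 hcell
  constructor <;> nlinarith

/-- The partial sums up to `a` and `b` each contribute at most 2 after multiplication by `2 sin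
(k/2)`, and `|sin (k/2)| ≥ |k|/4` on this range. -/
theorem abs_sum_Ioc_cos_le {k : ℝ} (hk0 : k ≠ 0) (hk : |k| ≤ Real.pi) {a b : ℕ} (hab : a ≤ b) :
    |∑ j ∈ Finset.Ioc a b, Real.cos (j * k)| ≤ 8 / |k| := by
  have h : ∀ n : ℕ, |2 * Real.sin (k / 2) * ∑ j ∈ Finset.Icc 1 n, Real.cos (j * k)| ≤ 2 := by
    intro n
    simpa using abs_two_sin_mul_sum_cos_le (a := fun _ => 1) (fun _ _ _ => le_rfl)
      (fun _ => zero_le_one) k n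
  have hs : ∑ j ∈ Finset.Ioc a b, Real.cos (j * k) =
      ∑ j ∈ Finset.Icc 1 b, Real.cos (j * k) - ∑ j ∈ Finset.Icc 1 a, Real.cos (j * k) := by
    rw [eq_sub_iff_add_eq, ← Finset.sum_union]
    · congr 1; ext j; simp only [Finset.mem_union, Finset.mem_Ioc, Finset.mem_Icc]; omega
    · rw [Finset.disjoint_left]; intro j; simp only [Finset.mem_Ioc, Finset.mem_Icc]; omega
  have hφ : |k / 2| ≤ Real.pi / 2 := by rw [abs_div, abs_two]; gcongr
  have hsin : Real.sin (k / 2) = Real.sinc (k / 2) * (k / 2) := by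
    rw [Real.sinc_of_ne_zero (by positivity)]; field_simp
  have h1 := one_half_le_sinc hφ
  have h2 : |2 * Real.sin (k / 2) * ∑ j ∈ Finset.Ioc a b, Real.cos (j * k)| ≤ 4 := by
    have e1 := h a
    have e2 := h b
    rw [hs, mul_sub]
    rw [abs_le] at e1 e2 ⊢
    constructor <;> linarith
  have hkp : 0 < |k| := abs_pos.2 hk0
  rw [le_div_iff₀ hkp]
  rw [abs_mul, abs_mul, abs_two, hsin, abs_mul, abs_of_nonneg (by linarith), abs_div, abs_two] at h2
  nlinarith [mul_nonneg (abs_nonneg (∑ j ∈ Finset.Ioc a b, Real.cos (j * k))) hkp.le]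

end RiemannSums

/-! ### The symbol of the pure power law: lattice sums giving `|k|^β`. -/

section FractionalSymbol

variable {β : ℝ}

theorem one_sub_cos_le (x : ℝ) : 1 - Real.cos x ≤ x ^ 2 / 2 := by
  linarith [Real.one_sub_sq_div_two_le_cos (x := x)]

theorem one_sub_cos_nonneg (x : ℝ) : 0 ≤ 1 - Real.cos x := by linarith [Real.cos_le_one x]

theorem one_sub_cos_div_rpow_le (k : ℝ) {u : ℝ} (hu : 0 < u) :
    (1 - Real.cos (k * u)) / u ^ (1 + β) ≤ k ^ 2 / 2 * u ^ (1 - β) := by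
  rw [div_le_iff₀ (by positivity), mul_assoc, ← Real.rpow_add hu]
  have := one_sub_cos_le (k * u)
  rw [show 1 - β + (1 + β) = (2 : ℕ) by push_cast; ring, Real.rpow_natCast]
  nlinarith

theorem one_sub_cos_div_rpow_le' (k : ℝ) {u : ℝ} (hu : 0 < u) :
    (1 - Real.cos (k * u)) / u ^ (1 + β) ≤ 2 * u ^ (-1 - β) := by
  rw [show -1 - β = -(1 + β) by ring, Real.rpow_neg hu.le, ← div_eq_mul_inv]
  gcongr
  linarith [Real.neg_one_le_cos (k * u)]

theorem continuousOn_one_sub_cos_div_rpow (β k : ℝ) :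
    ContinuousOn (fun u : ℝ => (1 - Real.cos (k * u)) / u ^ (1 + β)) (Set.Ioi 0) := by
  refine ContinuousOn.div (by fun_prop) ?_ fun x hx => (Real.rpow_pos_of_pos hx _).ne'
  exact continuousOn_id.rpow_const fun x hx => Or.inl (ne_of_gt hx)

theorem integrableOn_Ioc_rpow (hβ₂ : β < 2) : IntegrableOn (fun u : ℝ => u ^ (1 - β)) (Set.Ioc 0 1) := by
  rw [← intervalIntegrable_iff_integrableOn_Ioc_of_le zero_le_one]
  exact intervalIntegral.intervalIntegrable_rpow' (by linarith)

theorem integrableOn_one_sub_cos_div_rpow (hβ₁ : 1 < β) (hβ₂ : β < 2) (k : ℝ) :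
    IntegrableOn (fun u : ℝ => (1 - Real.cos (k * u)) / u ^ (1 + β)) (Set.Ioi 0) := by
  have hc := continuousOn_one_sub_cos_div_rpow β k
  rw [← Set.Ioc_union_Ioi_eq_Ioi zero_le_one]
  refine IntegrableOn.union ?_ ?_
  · refine Integrable.mono' ((integrableOn_Ioc_rpow hβ₂).const_mul (k ^ 2 / 2))
      ((hc.mono Set.Ioc_subset_Ioi_self).aestronglyMeasurable measurableSet_Ioc) ?_
    filter_upwards [ae_restrict_mem measurableSet_Ioc] with u hu
    have hu0 : 0 < u := hu.1
    rw [Real.norm_of_nonneg (div_nonneg (one_sub_cos_nonneg _) (by positivity))]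
    exact one_sub_cos_div_rpow_le k hu0
  · refine Integrable.mono' ((integrableOn_Ioi_rpow_of_lt (a := -1 - β) (by linarith)
      zero_lt_one).const_mul 2)
      ((hc.mono (Set.Ioi_subset_Ioi zero_le_one)).aestronglyMeasurable measurableSet_Ioi) ?_
    filter_upwards [ae_restrict_mem measurableSet_Ioi] with u hu
    have hu0 : 0 < u := lt_trans zero_lt_one hu
    rw [Real.norm_of_nonneg (div_nonneg (one_sub_cos_nonneg _) (by positivity))]
    exact one_sub_cos_div_rpow_le' k hu0

/-- Half of the integral of `(1 - cos u) / |u| ^ (1 + β)` over the line. -/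
def tailConst (β : ℝ) : ℝ := ∫ u in Set.Ioi (0 : ℝ), (1 - Real.cos u) / u ^ (1 + β)

theorem integral_one_sub_cos_div_abs_rpow (β : ℝ) :
    ∫ u : ℝ, (1 - Real.cos u) / |u| ^ (1 + β) = 2 * tailConst β := by
  rw [tailConst, ← integral_comp_abs (f := fun u : ℝ => (1 - Real.cos u) / u ^ (1 + β))]
  simp

theorem tailConst_pos (hβ₁ : 1 < β) (hβ₂ : β < 2) : 0 < tailConst β := by
  have hi := integrableOn_one_sub_cos_div_rpow hβ₁ hβ₂ 1
  simp only [one_mul] at hi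
  rw [tailConst, setIntegral_pos_iff_support_of_nonneg_ae _ hi]
  · have : Set.Ioo (0 : ℝ) 1 ⊆ (Function.support fun u : ℝ => (1 - Real.cos u) / u ^ (1 + β)) ∩
        Set.Ioi 0 := by
      intro u hu
      refine ⟨?_, hu.1⟩
      have h1 : Real.cos u < 1 := by
        rw [← Real.cos_zero]
        exact Real.cos_lt_cos_of_nonneg_of_le_pi le_rfl
          (hu.2.le.trans (by linarith [Real.pi_gt_three])) hu.1
      have h2 : 0 < u ^ (1 + β) := Real.rpow_pos_of_pos hu.1 _
      simp only [Function.mem_support]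
      exact (div_pos (by linarith) h2).ne'
    refine lt_of_lt_of_le ?_ (measure_mono this)
    simp
  · filter_upwards [ae_restrict_mem measurableSet_Ioi] with u hu
    have hu0 : (0 : ℝ) < u := hu
    exact div_nonneg (one_sub_cos_nonneg _) (by positivity)

theorem integral_one_sub_cos_mul_div_rpow (hβ₁ : 1 < β) (k : ℝ) :
    ∫ u in Set.Ioi (0 : ℝ), (1 - Real.cos (k * u)) / u ^ (1 + β) = |k| ^ β * tailConst β := by
  rcases eq_or_ne k 0 with rfl | hk
  · rw [abs_zero, Real.zero_rpow (by linarith)]; simp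
  have hk0 : 0 < |k| := abs_pos.2 hk
  have h := integral_comp_mul_left_Ioi (fun u : ℝ => (1 - Real.cos u) / u ^ (1 + β)) 0 hk0
  rw [mul_zero, smul_eq_mul] at h
  have h2 : ∫ u in Set.Ioi (0 : ℝ), (1 - Real.cos (k * u)) / u ^ (1 + β)
      = ∫ u in Set.Ioi (0 : ℝ), |k| ^ (1 + β) *
        ((1 - Real.cos (|k| * u)) / (|k| * u) ^ (1 + β)) := by
    refine setIntegral_congr_fun measurableSet_Ioi fun u hu => ?_
    have hu0 : (0 : ℝ) < u := hu
    have hc : Real.cos (k * u) = Real.cos (|k| * u) := by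
      rw [← Real.cos_abs (k * u), abs_mul, abs_of_pos hu0]
    have : |k| ^ (1 + β) ≠ 0 := by positivity
    simp only [hc]
    rw [Real.mul_rpow hk0.le hu0.le]
    field_simp
  rw [h2, integral_const_mul, h, tailConst, ← mul_assoc, Real.rpow_add hk0, Real.rpow_one]
  field_simp

theorem hasDerivAt_one_sub_cos_div_rpow (β k : ℝ) {u : ℝ} (hu : 0 < u) :
    HasDerivAt (fun u : ℝ => (1 - Real.cos (k * u)) * u ^ (-(1 + β)))
      (k * Real.sin (k * u) * u ^ (-(1 + β)) -
        (1 - Real.cos (k * u)) * ((1 + β) * u ^ (-(1 + β) - 1))) u := by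
  have h1 : HasDerivAt (fun u : ℝ => 1 - Real.cos (k * u)) (k * Real.sin (k * u)) u := by
    have h0 : HasDerivAt (fun u : ℝ => k * u) k u := by
      simpa using (hasDerivAt_id u).const_mul k
    refine (h0.cos.const_sub 1).congr_deriv (by ring)
  refine (h1.mul (Real.hasDerivAt_rpow_const (p := -(1 + β)) (Or.inl hu.ne'))).congr_deriv (by ring)

/-- Mean value inequality. Both terms of the derivative carry two factors of `k`, from `|sin y| ≤
|y|` and `1 - cos y ≤ y²/2`, and the resulting `u^(-β)` is summable over integers because `β > 1`.
-/
theorem abs_one_sub_cos_div_rpow_sub_le (hβ₁ : 1 < β) (hβ₂ : β < 2) (k : ℝ) {u v : ℝ}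
    (hu : 0 < u) (huv : u ≤ v) (hv : v ≤ u + 1) :
    |(1 - Real.cos (k * v)) / v ^ (1 + β) - (1 - Real.cos (k * u)) / u ^ (1 + β)|
      ≤ 3 * k ^ 2 * u ^ (-β) := by
  have hdiv : ∀ x : ℝ, 0 < x → (1 - Real.cos (k * x)) / x ^ (1 + β)
      = (1 - Real.cos (k * x)) * x ^ (-(1 + β)) := fun x hx => by
    rw [Real.rpow_neg hx.le, div_eq_mul_inv]
  rw [hdiv v (hu.trans_le huv), hdiv u hu]
  have h := (convex_Icc u (u + 1)).norm_image_sub_le_of_norm_hasDerivWithin_le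
    (f := fun u : ℝ => (1 - Real.cos (k * u)) * u ^ (-(1 + β)))
    (C := 3 * k ^ 2 * u ^ (-β))
    (fun x hx => (hasDerivAt_one_sub_cos_div_rpow β k (hu.trans_le hx.1)).hasDerivWithinAt)
    (fun x hx => ?_) (Set.left_mem_Icc.2 (by linarith)) ⟨huv, hv⟩
  · rw [Real.norm_eq_abs, Real.norm_eq_abs, abs_of_nonneg (sub_nonneg.2 huv)] at h
    refine h.trans (mul_le_of_le_one_right (by positivity) (by linarith))
  · have hx0 : 0 < x := hu.trans_le hx.1
    have e1 : x ^ (-β) ≤ u ^ (-β) := Real.rpow_le_rpow_of_nonpos hu hx.1 (by linarith)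
    have hp : 0 < x ^ (-(1 + β) - 1) := by positivity
    have e2 : x ^ (-(1 + β)) = x ^ (-(1 + β) - 1) * x := by
      rw [← Real.rpow_add_one hx0.ne']; ring_nf
    have e3 : x ^ (-β) = x ^ (-(1 + β) - 1) * x ^ 2 := by
      rw [← Real.rpow_natCast x 2, ← Real.rpow_add hx0]; push_cast; ring_nf
    have s1 : |k * Real.sin (k * x)| ≤ k ^ 2 * x := by
      rw [abs_mul]
      have h5 : |Real.sin (k * x)| ≤ |k| * x := by
        have h6 := Real.abs_sin_le_abs (x := k * x)
        rwa [abs_mul, abs_of_pos hx0] at h6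
      calc |k| * |Real.sin (k * x)| ≤ |k| * (|k| * x) := by gcongr
        _ = k ^ 2 * x := by rw [← mul_assoc, ← sq, sq_abs]
    have s2 := one_sub_cos_le (k * x)
    have s3 := one_sub_cos_nonneg (k * x)
    have t1 : |k * Real.sin (k * x) * x ^ (-(1 + β))| ≤ k ^ 2 * x ^ (-β) := by
      rw [abs_mul, e2, e3, abs_of_pos (mul_pos hp hx0)]
      calc _ ≤ k ^ 2 * x * (x ^ (-(1 + β) - 1) * x) := by gcongr
        _ = _ := by ring
    have t2 : |(1 - Real.cos (k * x)) * ((1 + β) * x ^ (-(1 + β) - 1))| ≤ 2 * k ^ 2 * x ^ (-β) := by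
      have : 0 ≤ (1 + β) * x ^ (-(1 + β) - 1) := mul_nonneg (by linarith) hp.le
      rw [abs_of_nonneg (mul_nonneg s3 this), e3]
      calc _ ≤ (k * x) ^ 2 / 2 * (3 * x ^ (-(1 + β) - 1)) := by gcongr; linarith
        _ ≤ _ := by nlinarith [mul_nonneg (sq_nonneg (k * x)) hp.le]
    rw [Real.norm_eq_abs]
    refine (abs_sub _ _).trans ?_
    have : k ^ 2 * x ^ (-β) ≤ k ^ 2 * u ^ (-β) := by gcongr
    linarith

theorem exists_sum_one_sub_cos_div_rpow_bound (hβ₁ : 1 < β) (hβ₂ : β < 2) :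
    ∃ C : ℝ, 0 < C ∧ ∀ (k : ℝ) (n : ℕ), 0 < n →
      |∑ j ∈ Finset.Icc 1 n, (1 - Real.cos (k * j)) / (j : ℝ) ^ (1 + β) - |k| ^ β * tailConst β|
        ≤ C * (k ^ 2 + (n : ℝ) ^ (-β)) := by
  have hsum : Summable fun n : ℕ => (n : ℝ) ^ (-β) := Real.summable_nat_rpow.2 (by linarith)
  set A := ∑' n : ℕ, (n : ℝ) ^ (-β)
  have hA : 0 ≤ A := tsum_nonneg fun n => by positivity
  -- The three constants account for the variation over unit cells, the interval `[0, 1]` that the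
  -- sum omits, and the tail of the integral beyond `n + 1`.
  refine ⟨3 * A + 1 / (2 * (2 - β)) + 2, ?_, fun k n hn => ?_⟩
  · have : 0 < 1 / (2 * (2 - β)) := by apply one_div_pos.2; linarith
    positivity
  set ψ : ℝ → ℝ := fun u => (1 - Real.cos (k * u)) / u ^ (1 + β) with hψ
  have hi : IntegrableOn ψ (Set.Ioi 0) := integrableOn_one_sub_cos_div_rpow hβ₁ hβ₂ k
  have hψ0 : ∀ u, 0 < u → 0 ≤ ψ u := fun u hu =>
    div_nonneg (one_sub_cos_nonneg _) (by positivity)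
  have hii : ∀ a b : ℝ, 0 ≤ a → 0 ≤ b → IntervalIntegrable ψ volume a b := fun a b ha hb =>
    intervalIntegrable_iff.2 (hi.mono_set fun x hx => lt_of_le_of_lt (le_min ha hb) hx.1)
  have h1 : |∑ j ∈ Finset.Icc 1 n, ψ j - ∫ u in (1 : ℝ)..(n + 1 : ℕ), ψ u|
      ≤ 3 * k ^ 2 * ∑ j ∈ Finset.Icc 1 n, (j : ℝ) ^ (-β) := by
    clear hn
    induction n with
    | zero => simp
    | succ n ih =>
      rw [Finset.sum_Icc_succ_top (by omega), Finset.sum_Icc_succ_top (by omega),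
        ← intervalIntegral.integral_add_adjacent_intervals
          (hii 1 (n + 1 : ℕ) zero_le_one (by positivity)) (hii _ _ (by positivity) (by positivity))]
      have hpos : (0 : ℝ) < (n + 1 : ℕ) := by positivity
      have h2 : |ψ (n + 1 : ℕ) - ∫ u in ((n + 1 : ℕ) : ℝ)..(n + 1 + 1 : ℕ), ψ u|
          ≤ 3 * k ^ 2 * ((n + 1 : ℕ) : ℝ) ^ (-β) := by
        have e : ψ (n + 1 : ℕ) = ∫ u in ((n + 1 : ℕ) : ℝ)..(n + 1 + 1 : ℕ), ψ (n + 1 : ℕ) := by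
          rw [intervalIntegral.integral_const]; push_cast; simp
        rw [e, ← intervalIntegral.integral_sub (by simp) (hii _ _ (by positivity) (by positivity))]
        have h3 := intervalIntegral.norm_integral_le_of_norm_le_const
          (a := ((n + 1 : ℕ) : ℝ)) (b := (n + 1 + 1 : ℕ))
          (C := 3 * k ^ 2 * ((n + 1 : ℕ) : ℝ) ^ (-β))
          (f := fun u => ψ (n + 1 : ℕ) - ψ u) fun u hu => by
            rw [Set.uIoc_of_le (by push_cast; linarith)] at hu
            rw [Real.norm_eq_abs, abs_sub_comm]
            exact abs_one_sub_cos_div_rpow_sub_le hβ₁ hβ₂ k hpos hu.1.le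
              (by have := hu.2; push_cast at this ⊢; linarith)
        refine h3.trans (le_of_eq ?_)
        push_cast
        rw [show (n : ℝ) + 1 + 1 - (n + 1) = 1 by ring, abs_one, mul_one]
      rw [mul_add]
      calc _ = |(∑ j ∈ Finset.Icc 1 n, ψ j - ∫ u in (1 : ℝ)..(n + 1 : ℕ), ψ u) +
          (ψ (n + 1 : ℕ) - ∫ u in ((n + 1 : ℕ) : ℝ)..(n + 1 + 1 : ℕ), ψ u)| := by congr 1; ring
        _ ≤ _ := abs_add_le _ _
        _ ≤ _ := add_le_add ih h2
  have h2 : ∑ j ∈ Finset.Icc 1 n, (j : ℝ) ^ (-β) ≤ A :=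
    hsum.sum_le_tsum _ fun j _ => by positivity
  have h3 : 0 ≤ ∫ u in (0 : ℝ)..1, ψ u := by
    rw [intervalIntegral.integral_of_le zero_le_one]
    exact setIntegral_nonneg measurableSet_Ioc fun u hu => hψ0 u hu.1
  have h4 : ∫ u in (0 : ℝ)..1, ψ u ≤ 1 / (2 * (2 - β)) * k ^ 2 := by
    rw [intervalIntegral.integral_of_le zero_le_one]
    have e1 : ∫ u in Set.Ioc (0 : ℝ) 1, ψ u ≤ ∫ u in Set.Ioc (0 : ℝ) 1, k ^ 2 / 2 * u ^ (1 - β) :=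
      setIntegral_mono_on (hi.mono_set Set.Ioc_subset_Ioi_self)
        ((integrableOn_Ioc_rpow hβ₂).const_mul _) measurableSet_Ioc
        fun u hu => one_sub_cos_div_rpow_le k hu.1
    refine e1.trans (le_of_eq ?_)
    rw [← intervalIntegral.integral_of_le zero_le_one, intervalIntegral.integral_const_mul,
      integral_rpow (Or.inl (by linarith)), Real.zero_rpow (by linarith), Real.one_rpow]
    have : 2 - β ≠ 0 := by linarith
    rw [show 1 - β + 1 = 2 - β by ring]
    field_simp
    ring
  have hn1 : (0 : ℝ) < (n + 1 : ℕ) := by positivity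
  have h5 : 0 ≤ ∫ u in Set.Ioi ((n + 1 : ℕ) : ℝ), ψ u :=
    setIntegral_nonneg measurableSet_Ioi fun u hu => hψ0 u (hn1.trans hu)
  have h6 : ∫ u in Set.Ioi ((n + 1 : ℕ) : ℝ), ψ u ≤ 2 * (n : ℝ) ^ (-β) := by
    have e1 : ∫ u in Set.Ioi ((n + 1 : ℕ) : ℝ), ψ u
        ≤ ∫ u in Set.Ioi ((n + 1 : ℕ) : ℝ), 2 * u ^ (-1 - β) :=
      setIntegral_mono_on (hi.mono_set (Set.Ioi_subset_Ioi hn1.le))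
        ((integrableOn_Ioi_rpow_of_lt (by linarith) hn1).const_mul _) measurableSet_Ioi
        fun u hu => one_sub_cos_div_rpow_le' k (hn1.trans hu)
    refine e1.trans ?_
    rw [integral_const_mul, integral_Ioi_rpow_of_lt (by linarith) hn1]
    gcongr
    rw [show -1 - β + 1 = -β by ring, neg_div_neg_eq, div_le_iff₀ (by linarith)]
    have hn0 : (0 : ℝ) < n := by exact_mod_cast hn
    have e2 : ((n + 1 : ℕ) : ℝ) ^ (-β) ≤ (n : ℝ) ^ (-β) :=
      Real.rpow_le_rpow_of_nonpos hn0 (by push_cast; linarith) (by linarith)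
    have e3 : 0 ≤ (n : ℝ) ^ (-β) := by positivity
    nlinarith
  have h7 : |k| ^ β * tailConst β = (∫ u in (0 : ℝ)..1, ψ u) +
      (∫ u in (1 : ℝ)..(n + 1 : ℕ), ψ u) + ∫ u in Set.Ioi ((n + 1 : ℕ) : ℝ), ψ u := by
    rw [← integral_one_sub_cos_mul_div_rpow hβ₁,
      intervalIntegral.integral_add_adjacent_intervals (hii _ _ le_rfl zero_le_one)
      (hii _ _ zero_le_one hn1.le), intervalIntegral.integral_interval_add_Ioi hi
        (hi.mono_set (Set.Ioi_subset_Ioi hn1.le))]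
  have h8 : 3 * k ^ 2 * ∑ j ∈ Finset.Icc 1 n, (j : ℝ) ^ (-β) ≤ 3 * A * k ^ 2 := by
    nlinarith [mul_le_mul_of_nonneg_left h2 (sq_nonneg k)]
  have h9 : 0 ≤ (n : ℝ) ^ (-β) := by positivity
  have h10 : 0 ≤ 1 / (2 * (2 - β)) := by apply one_div_nonneg.2; linarith
  rw [h7]
  have h11 := mul_nonneg hA h9
  have h12 := mul_nonneg h10 h9
  have h13 := mul_nonneg hA (sq_nonneg k)
  have h14 := mul_nonneg h10 (sq_nonneg k)
  rw [abs_le] at h1 ⊢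
  constructor <;> nlinarith [sq_nonneg k]

end FractionalSymbol

/-! ### Bounds on the density and on sums of `1 / (r^β + |q|^β)`. -/

section Density

variable {β h₀ : ℝ} {f σ : ℝ → ℝ}

theorem IsHeavyTailedDensity.exists_abs_sub_le (hf : IsHeavyTailedDensity β h₀ f) :
    ∃ K : ℝ, 0 < K ∧ ∀ x, 0 < x →
      |f x - h₀ / x ^ (1 + β)| ≤ K / (x ^ (1 + β) * √(1 + x ^ 2) ^ 3) := by
  obtain ⟨h, -, h1, C, hC⟩ := hf.tail
  refine ⟨max C 1, by positivity, fun x hx => ?_⟩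
  have hp : 0 < x ^ (1 + β) := by positivity
  rw [h1 x hx.ne', abs_of_pos hx, ← sub_div, abs_div, abs_of_pos hp, mul_comm, ← div_div]
  gcongr
  refine (hC x).trans ?_
  gcongr
  exact le_max_left _ _

theorem one_le_sqrt_one_add_sq (x : ℝ) : 1 ≤ √(1 + x ^ 2) := by
  rw [Real.one_le_sqrt]; nlinarith

theorem le_sqrt_one_add_sq (x : ℝ) : x ≤ √(1 + x ^ 2) :=
  Real.le_sqrt_of_sq_le (by linarith)

/-- The exponent `β` in place of `1 + β` is wasteful but still integrable, and lets `greenConst`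
serve for bounding the normalisation too. -/
theorem IsHeavyTailedDensity.exists_le_div (hf : IsHeavyTailedDensity β h₀ f) (h0 : 0 < h₀)
    (hβ₁ : 1 < β) :
    ∃ K : ℝ, 0 < K ∧ ∀ x, f x ≤ K / (1 + |x| ^ β) := by
  obtain ⟨K, hK, h1⟩ := hf.exists_abs_sub_le
  obtain ⟨M, hM⟩ := isCompact_Icc.exists_bound_of_continuousOn (s := Set.Icc (-1 : ℝ) 1)
    hf.smooth.continuous.continuousOn
  have hM0 : 0 ≤ M := (norm_nonneg _).trans (hM 0 (by simp))
  refine ⟨2 * (M + K + h₀), by positivity, fun x => ?_⟩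
  rw [le_div_iff₀ (by positivity)]
  rcases le_or_gt |x| 1 with hx | hx
  · have e1 : f x ≤ M := (le_abs_self _).trans (hM x (abs_le.1 hx))
    have e2 : |x| ^ β ≤ 1 := Real.rpow_le_one (abs_nonneg x) hx (by linarith)
    have e3 : 0 ≤ |x| ^ β := by positivity
    nlinarith [hf.nonneg x]
  · have hx0 : 0 < |x| := by linarith
    have e0 : f x = f |x| := by
      rcases abs_choice x with h | h <;> rw [h]
      rw [hf.symm]
    have e1 := (abs_le.1 (h1 |x| hx0)).2
    have e2 : 1 ≤ |x| ^ β := Real.one_le_rpow hx.le (by linarith)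
    have e3 : |x| ^ β ≤ |x| ^ (1 + β) := Real.rpow_le_rpow_of_exponent_le hx.le (by linarith)
    have e4 : K / (|x| ^ (1 + β) * √(1 + |x| ^ 2) ^ 3) ≤ K / |x| ^ β := by
      gcongr
      refine le_trans e3 (le_mul_of_one_le_right (by positivity) ?_)
      exact one_le_pow₀ (one_le_sqrt_one_add_sq _)
    have e5 : h₀ / |x| ^ (1 + β) ≤ h₀ / |x| ^ β := by gcongr
    have e6 : f |x| ≤ (K + h₀) / |x| ^ β := by rw [add_div]; linarith
    rw [le_div_iff₀ (by positivity)] at e6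
    have := hf.nonneg |x|
    rw [e0]
    nlinarith

theorem IsHeavyTailedDensity.exists_div_le (hf : IsHeavyTailedDensity β h₀ f) (h0 : 0 < h₀) :
    ∃ Y : ℝ, 0 < Y ∧ ∀ x, Y ≤ x → h₀ / 2 / x ^ (1 + β) ≤ f x := by
  obtain ⟨K, hK, h1⟩ := hf.exists_abs_sub_le
  refine ⟨max 1 (2 * K / h₀), by positivity, fun x hx => ?_⟩
  have hx1 : 1 ≤ x := (le_max_left _ _).trans hx
  have hx2 : 2 * K / h₀ ≤ x := (le_max_right _ _).trans hx
  have hx0 : 0 < x := by linarith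
  have hp : 0 < x ^ (1 + β) := by positivity
  have e1 := (abs_le.1 (h1 x hx0)).1
  have e2 : K / (x ^ (1 + β) * √(1 + x ^ 2) ^ 3) ≤ h₀ / 2 / x ^ (1 + β) := by
    rw [mul_comm, ← div_div]
    refine div_le_div_of_nonneg_right ?_ hp.le
    rw [div_le_iff₀ (by positivity)]
    rw [div_le_iff₀ h0] at hx2
    have e3 : x ≤ √(1 + x ^ 2) ^ 3 := (le_sqrt_one_add_sq x).trans
      (le_self_pow₀ (one_le_sqrt_one_add_sq x) (by norm_num))
    nlinarith
  have e4 : h₀ / x ^ (1 + β) = h₀ / 2 / x ^ (1 + β) + h₀ / 2 / x ^ (1 + β) := by ring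
  linarith

/-- The rescaled integral `∫₀^∞ dq / (1 + q ^ β)`. -/
def greenConst (β : ℝ) : ℝ := ∫ q in Set.Ioi (0 : ℝ), 1 / (1 + |q| ^ β)

theorem continuous_one_div_add_rpow (hβ₁ : 1 < β) {A B : ℝ} (hA : 0 < A) (hB : 0 ≤ B) :
    Continuous fun q : ℝ => 1 / (A + B * |q| ^ β) := by
  refine continuous_const.div ?_ fun q => by positivity
  exact continuous_const.add (continuous_const.mul (continuous_abs.rpow_const fun _ => Or.inr (by linarith)))

theorem antitoneOn_one_div_add_rpow (hβ₁ : 1 < β) {A B : ℝ} (hA : 0 < A) (hB : 0 ≤ B) :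
    AntitoneOn (fun q : ℝ => 1 / (A + B * |q| ^ β)) (Set.Ici 0) := by
  intro x hx y hy hxy
  have hx0 : (0 : ℝ) ≤ x := hx
  simp only
  rw [abs_of_nonneg hx0, abs_of_nonneg (hx0.trans hxy)]
  gcongr

theorem one_div_add_rpow_le {A B : ℝ} (hA : 0 < A) (hB : 0 < B) {q : ℝ} (hq : 0 < q) :
    1 / (A + B * |q| ^ β) ≤ 1 / B * q ^ (-β) := by
  rw [abs_of_pos hq, Real.rpow_neg hq.le, ← one_div, one_div_mul_one_div]
  refine one_div_le_one_div_of_le (by positivity) ?_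
  linarith

theorem integrableOn_one_div_add_rpow (hβ₁ : 1 < β) {A B : ℝ} (hA : 0 < A) (hB : 0 < B) :
    IntegrableOn (fun q : ℝ => 1 / (A + B * |q| ^ β)) (Set.Ioi 0) := by
  have hc := continuous_one_div_add_rpow hβ₁ hA hB.le
  rw [← Set.Ioc_union_Ioi_eq_Ioi zero_le_one]
  refine IntegrableOn.union ?_ ?_
  · exact (hc.integrableOn_Icc (a := 0) (b := 1)).mono_set Set.Ioc_subset_Icc_self
  · refine Integrable.mono' ((integrableOn_Ioi_rpow_of_lt (a := -β) (by linarith)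
      zero_lt_one).const_mul (1 / B)) hc.aestronglyMeasurable ?_
    filter_upwards [ae_restrict_mem measurableSet_Ioi] with q hq
    have hq0 : 0 < q := lt_trans zero_lt_one hq
    rw [Real.norm_of_nonneg (by positivity)]
    exact one_div_add_rpow_le hA hB hq0

theorem integral_Ioi_one_div_add_rpow_le (hβ₁ : 1 < β) {A B : ℝ} (hA : 0 < A) (hB : 0 < B)
    {y : ℝ} (hy : 1 ≤ y) :
    ∫ q in Set.Ioi y, 1 / (A + B * |q| ^ β) ≤ 1 / (B * (β - 1)) := by
  have hy0 : 0 < y := by linarith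
  have h1 : ∫ q in Set.Ioi y, 1 / (A + B * |q| ^ β) ≤ ∫ q in Set.Ioi y, 1 / B * q ^ (-β) :=
    setIntegral_mono_on ((integrableOn_one_div_add_rpow hβ₁ hA hB).mono_set
      (Set.Ioi_subset_Ioi hy0.le))
      ((integrableOn_Ioi_rpow_of_lt (by linarith) hy0).const_mul _) measurableSet_Ioi
      fun q hq => one_div_add_rpow_le hA hB (hy0.trans hq)
  refine h1.trans ?_
  rw [integral_const_mul, integral_Ioi_rpow_of_lt (by linarith) hy0,
    show -y ^ (-β + 1) / (-β + 1) = y ^ (-β + 1) / (β - 1) by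
      rw [neg_div, ← div_neg]; ring_nf, ← one_div_mul_one_div]
  have : y ^ (-β + 1) ≤ 1 := Real.rpow_le_one_of_one_le_of_nonpos hy (by linarith)
  have : 0 < β - 1 := by linarith
  gcongr

theorem greenConst_nonneg (β : ℝ) : 0 ≤ greenConst β :=
  setIntegral_nonneg measurableSet_Ioi fun q _ => by positivity

theorem integral_Ioi_one_div_rpow_add_rpow (β : ℝ) {r : ℝ} (hr : 0 < r) :
    ∫ q in Set.Ioi (0 : ℝ), 1 / (r ^ β + |q| ^ β) = r ^ (1 - β) * greenConst β := by
  have h := integral_comp_mul_left_Ioi (fun u : ℝ => 1 / (r ^ β + |u| ^ β)) 0 hr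
  rw [mul_zero, smul_eq_mul] at h
  have h2 : ∀ u : ℝ, 1 / (r ^ β + |r * u| ^ β) = r ^ (-β) * (1 / (1 + |u| ^ β)) := by
    intro u
    rw [abs_mul, abs_of_pos hr, Real.mul_rpow hr.le (abs_nonneg u), Real.rpow_neg hr.le]
    have : 0 < r ^ β := by positivity
    field_simp
  simp_rw [h2] at h
  rw [integral_const_mul] at h
  rw [greenConst, sub_eq_add_neg, Real.rpow_add hr, Real.rpow_one, mul_assoc, h]
  field_simp

/-- Sums of `1 / (r ^ β + |q| ^ β)` over the dual lattice of the torus. -/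
theorem sum_one_div_rpow_add_rpow_le (hβ₁ : 1 < β) {r Δ : ℝ} (hr : 0 < r) (hΔ : 0 < Δ)
    (hrΔ : Δ ≤ 7 * r) (N : ℕ) [NeZero N] :
    ∑ p : ZMod N, 1 / (r ^ β + |rep p * Δ| ^ β) ≤ (7 + 2 * greenConst β) * (r ^ (1 - β) / Δ) := by
  have h := sum_rep_eq (N := N) (fun j => 1 / (r ^ β + |j * Δ| ^ β)) (fun j => by
    push_cast; rw [neg_mul, abs_neg])
  have hrb : 0 < r ^ β := by positivity
  have h1 : ∀ n : ℕ, ∑ j ∈ Finset.Icc 1 n, 1 / (r ^ β + |(j : ℝ) * Δ| ^ β)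
      ≤ r ^ (1 - β) * greenConst β / Δ := by
    intro n
    have e := mul_sum_le_integral_Ioi (F := fun q => 1 / (r ^ β + 1 * |q| ^ β))
      ((antitoneOn_one_div_add_rpow hβ₁ hrb zero_le_one).mono Set.Ioi_subset_Ici_self)
      (fun x _ => by positivity) (integrableOn_one_div_add_rpow hβ₁ hrb zero_lt_one) hΔ n
    simp only [one_mul] at e
    rw [integral_Ioi_one_div_rpow_add_rpow β hr] at e
    rw [le_div_iff₀ hΔ]
    linarith
  -- The zero mode `r^(-β)` is absorbed because the spacing satisfies `Δ ≤ 7r`; the 7 is an upper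
  -- bound for `2π`.
  have h2 : 1 / (r ^ β + |((0 : ℤ) : ℝ) * Δ| ^ β) ≤ 7 * (r ^ (1 - β) / Δ) := by
    rw [Int.cast_zero, zero_mul, abs_zero, Real.zero_rpow (by linarith), add_zero, one_div,
      ← Real.rpow_neg hr.le, sub_eq_add_neg, Real.rpow_add hr, Real.rpow_one, mul_div_assoc',
      le_div_iff₀ hΔ]
    have : 0 < r ^ (-β) := by positivity
    nlinarith
  rw [h]
  have e1 := h1 ((N - 1) / 2)
  have e2 := h1 (N / 2)
  simp only [Int.cast_natCast]
  calc _ ≤ 7 * (r ^ (1 - β) / Δ) + r ^ (1 - β) * greenConst β / Δ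
        + r ^ (1 - β) * greenConst β / Δ := by gcongr
    _ = _ := by ring

/-- This function is `y²`, from `1 - cos`, times the deviation `y^(-1-β) ⟨y⟩⁻³` of the density from
its power law. -/
theorem integrableOn_remainder (hβ₁ : 1 < β) (hβ₂ : β < 2) :
    IntegrableOn (fun y : ℝ => y ^ (1 - β) * (1 / √(1 + y ^ 2) ^ 3)) (Set.Ioi 0) := by
  have hc : ContinuousOn (fun y : ℝ => y ^ (1 - β) * (1 / √(1 + y ^ 2) ^ 3)) (Set.Ioi 0) := by
    refine ContinuousOn.mul (continuousOn_id.rpow_const fun x hx => Or.inl (ne_of_gt hx)) ?_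
    refine Continuous.continuousOn (Continuous.div (by fun_prop) (by fun_prop) fun x => ?_)
    have := one_le_sqrt_one_add_sq x
    positivity
  rw [← Set.Ioc_union_Ioi_eq_Ioi zero_le_one]
  refine IntegrableOn.union ?_ ?_
  · refine Integrable.mono' (integrableOn_Ioc_rpow hβ₂)
      ((hc.mono Set.Ioc_subset_Ioi_self).aestronglyMeasurable measurableSet_Ioc) ?_
    filter_upwards [ae_restrict_mem measurableSet_Ioc] with u hu
    have hu0 : 0 < u := hu.1
    rw [Real.norm_of_nonneg (by positivity)]
    refine mul_le_of_le_one_right (by positivity) ?_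
    have := one_le_sqrt_one_add_sq u
    rw [div_le_one (by positivity)]
    exact one_le_pow₀ this
  · refine Integrable.mono' (integrableOn_Ioi_rpow_of_lt (a := -2) (by norm_num) zero_lt_one)
      ((hc.mono (Set.Ioi_subset_Ioi zero_le_one)).aestronglyMeasurable measurableSet_Ioi) ?_
    filter_upwards [ae_restrict_mem measurableSet_Ioi] with u hu
    have hu1 : 1 ≤ u := le_of_lt hu
    have hu0 : 0 < u := by linarith
    rw [Real.norm_of_nonneg (by positivity)]
    have e1 : u ^ (1 - β) ≤ 1 := Real.rpow_le_one_of_one_le_of_nonpos hu1 (by linarith)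
    have e2 : u ^ 2 ≤ √(1 + u ^ 2) ^ 3 := by
      have := one_le_sqrt_one_add_sq u
      calc u ^ 2 ≤ √(1 + u ^ 2) ^ 2 := by gcongr; exact le_sqrt_one_add_sq u
        _ ≤ _ := pow_le_pow_right₀ this (by norm_num)
    rw [Real.rpow_neg hu0.le, show (2 : ℝ) = (2 : ℕ) by norm_num, Real.rpow_natCast]
    calc _ ≤ 1 * (1 / u ^ 2) := by gcongr
      _ = _ := by simp

theorem antitoneOn_remainder (hβ₁ : 1 < β) :
    AntitoneOn (fun y : ℝ => y ^ (1 - β) * (1 / √(1 + y ^ 2) ^ 3)) (Set.Ioi 0) := by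
  intro x hx y hy hxy
  have hx0 : (0 : ℝ) < x := hx
  have hy0 : (0 : ℝ) < y := hy
  have := one_le_sqrt_one_add_sq x
  have e : x ^ (1 - β) ≥ y ^ (1 - β) := Real.rpow_le_rpow_of_nonpos hx0 hxy (by linarith)
  simp only
  gcongr

end Density

/-! ### The symbol of the band matrix: expansion at low momenta, gap at high momenta. -/

section Symbol

variable {β h₀ : ℝ} {f σ : ℝ → ℝ}

/-- The second alternative covers the class of `-N/2` for even `N`, which is its own negative. -/
theorem rep_neg_eq {N : ℕ} [NeZero N] (x : ZMod N) : rep (-x) = -rep x ∨ rep (-x) = rep x := by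
  obtain ⟨a1, a2, a3⟩ := rep_spec x
  obtain ⟨b1, b2, b3⟩ := rep_spec (-x)
  have h : ((rep (-x) + rep x : ℤ) : ZMod N) = 0 := by push_cast; rw [a3, b3]; simp
  rw [ZMod.intCast_zmod_eq_zero_iff_dvd] at h
  obtain ⟨k, hk⟩ := h
  have hN : (0 : ℤ) < N := by exact_mod_cast Nat.pos_of_ne_zero (NeZero.ne N)
  have k1 : k < 1 := by
    by_contra hc
    push Not at hc
    nlinarith
  have k2 : -2 < k := by
    by_contra hc
    push Not at hc
    nlinarith
  obtain rfl | rfl : k = 0 ∨ k = -1 := by omega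
  · left; omega
  · right; omega

theorem weight_neg (hf : IsHeavyTailedDensity β h₀ f) (hσ : IsCutoff σ) {N W : ℕ} [NeZero N]
    (x : ZMod N) : weight f σ N W (-x) = weight f σ N W x := by
  unfold weight
  rcases rep_neg_eq x with h | h <;> rw [h]
  push_cast
  rw [neg_div, neg_div, hf.symm, hσ.symm]

theorem weight_nonneg (hf : IsHeavyTailedDensity β h₀ f) (hσ : IsCutoff σ) {N W : ℕ}
    (x : ZMod N) : 0 ≤ weight f σ N W x := mul_nonneg (hf.nonneg _) (hσ.nonneg _)

/-- Three errors: replacing `f` by its power law costs `(kW)²` by integrability of the remainder;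
removing `σ` affects only `j > aN` and costs `(W/N)^β`; the pure power sum is the previous lattice
estimate. -/
theorem exists_half_symbol_bound (hβ₁ : 1 < β) (hβ₂ : β < 2) (h0 : 0 < h₀)
    (hf : IsHeavyTailedDensity β h₀ f) (hσ : IsCutoff σ) :
    ∃ C : ℝ, 0 < C ∧ ∀ (N W n : ℕ) (k : ℝ), 1 ≤ W → 1 ≤ N → N ≤ 4 * n → 2 * n ≤ N →
      |(∑ j ∈ Finset.Icc 1 n, f (j / W) * σ (j / N) * (1 - Real.cos (k * j))) / W
        - h₀ * tailConst β * |k * W| ^ β| ≤ C * ((k * W) ^ 2 + ((W : ℝ) / N) ^ β) := by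
  obtain ⟨K, hK, hK1⟩ := hf.exists_abs_sub_le
  obtain ⟨C, hC, hC1⟩ := exists_sum_one_sub_cos_div_rpow_bound hβ₁ hβ₂
  obtain ⟨a, b, ha, hab, hb, hσa, hσb⟩ := hσ.bump
  set M := ∫ y in Set.Ioi (0 : ℝ), y ^ (1 - β) * (1 / √(1 + y ^ 2) ^ 3) with hM
  have hM0 : 0 ≤ M := setIntegral_nonneg measurableSet_Ioi fun y hy => by
    have hy0 : (0 : ℝ) < y := hy
    positivity
  refine ⟨K * M + 2 * h₀ / a ^ (1 + β) + h₀ * C + h₀ * C * 4 ^ β, by positivity,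
    fun N W n k hW hN hn1 hn2 => ?_⟩
  have hW0 : (0 : ℝ) < W := by exact_mod_cast hW
  have hW1 : (1 : ℝ) ≤ W := by exact_mod_cast hW
  have hN0 : (0 : ℝ) < N := by exact_mod_cast hN
  have hn0 : 0 < n := by omega
  set ψ : ℕ → ℝ := fun j => (1 - Real.cos (k * j)) / (j : ℝ) ^ (1 + β) with hψ
  have hterm : ∀ j ∈ Finset.Icc 1 n,
      |f (j / W) * σ (j / N) * (1 - Real.cos (k * j)) - h₀ * (W : ℝ) ^ (1 + β) * ψ j| ≤
        K * (k * W) ^ 2 * (((j : ℝ) * (1 / W)) ^ (1 - β) * (1 / √(1 + ((j : ℝ) * (1 / W)) ^ 2) ^ 3))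
        + 2 * h₀ * (W : ℝ) ^ (1 + β) / (a * N) ^ (1 + β) := by
    intro j hj
    have hj1 : 1 ≤ j := (Finset.mem_Icc.1 hj).1
    have hj0 : (0 : ℝ) < j := by exact_mod_cast hj1
    have hx : (j : ℝ) * (1 / W) = j / W := by ring
    rw [hx]
    set x : ℝ := j / W with hxd
    have hx0 : 0 < x := by positivity
    have hc0 := one_sub_cos_nonneg (k * j)
    have hs := one_le_sqrt_one_add_sq x
    have hdec : f x * σ (j / N) * (1 - Real.cos (k * j)) - h₀ * (W : ℝ) ^ (1 + β) * ψ j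
        = (f x - h₀ / x ^ (1 + β)) * σ (j / N) * (1 - Real.cos (k * j))
          + h₀ * (W : ℝ) ^ (1 + β) * ψ j * (σ (j / N) - 1) := by
      have : x ^ (1 + β) = (j : ℝ) ^ (1 + β) / (W : ℝ) ^ (1 + β) :=
        Real.div_rpow hj0.le hW0.le _
      rw [this, hψ]
      field_simp
      ring
    have h1 : |(f x - h₀ / x ^ (1 + β)) * σ (j / N) * (1 - Real.cos (k * j))|
        ≤ K * (k * W) ^ 2 * (x ^ (1 - β) * (1 / √(1 + x ^ 2) ^ 3)) := by
      rw [abs_mul, abs_mul, abs_of_nonneg (hσ.nonneg _), abs_of_nonneg hc0]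
      have e1 : 1 - Real.cos (k * j) ≤ (k * W) ^ 2 * x ^ 2 := by
        have := one_sub_cos_le (k * j)
        have e : (k * W) ^ 2 * x ^ 2 = (k * j) ^ 2 := by rw [hxd]; field_simp
        rw [e]; nlinarith [sq_nonneg (k * j)]
      calc _ ≤ K / (x ^ (1 + β) * √(1 + x ^ 2) ^ 3) * 1 * ((k * W) ^ 2 * x ^ 2) := by
            gcongr
            · exact hσ.nonneg _
            · exact hK1 x hx0
            · exact hσ.le_one _
        _ = _ := by
            have : x ^ (1 - β) * x ^ (1 + β) = x ^ 2 := by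
              rw [← Real.rpow_add hx0, ← Real.rpow_natCast]; push_cast; ring_nf
            rw [← this]
            field_simp
    have hψ0 : 0 ≤ ψ j := div_nonneg hc0 (by positivity)
    have h2 : |h₀ * (W : ℝ) ^ (1 + β) * ψ j * (σ (j / N) - 1)|
        ≤ 2 * h₀ * (W : ℝ) ^ (1 + β) / (a * N) ^ (1 + β) := by
      rcases le_or_gt ((j : ℝ) / N) a with h | h
      · rw [hσa _ (by rwa [abs_of_pos (by positivity)]), sub_self, mul_zero, abs_zero]
        positivity
      · have e1 : |σ (j / N) - 1| ≤ 1 := by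
          have := hσ.nonneg (j / N)
          have := hσ.le_one (j / N)
          rw [abs_le]; constructor <;> linarith
        rw [lt_div_iff₀ hN0] at h
        have e2 : ψ j ≤ 2 / (a * N) ^ (1 + β) := by
          have : 1 - Real.cos (k * j) ≤ 2 := by linarith [Real.neg_one_le_cos (k * j)]
          simp only [hψ]
          gcongr
        rw [abs_mul, abs_of_nonneg (by positivity)]
        calc _ ≤ h₀ * (W : ℝ) ^ (1 + β) * (2 / (a * N) ^ (1 + β)) * 1 := by gcongr
          _ = _ := by ring
    rw [hdec]
    exact (abs_add_le _ _).trans (add_le_add h1 h2)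
  have hR := mul_sum_le_integral_Ioi (antitoneOn_remainder hβ₁)
    (fun y hy => by positivity) (integrableOn_remainder hβ₁ hβ₂) (one_div_pos.2 hW0) n
  rw [← hM] at hR
  have hsum := (Finset.abs_sum_le_sum_abs _ _).trans (Finset.sum_le_sum hterm)
  rw [Finset.sum_sub_distrib, ← Finset.mul_sum, Finset.sum_add_distrib, ← Finset.mul_sum,
    Finset.sum_const, Nat.card_Icc, nsmul_eq_mul] at hsum
  simp only [add_tsub_cancel_right] at hsum
  set T := ∑ j ∈ Finset.Icc 1 n, f (j / W) * σ (j / N) * (1 - Real.cos (k * j))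
  set P := ∑ j ∈ Finset.Icc 1 n, ψ j with hP
  set Q := ∑ j ∈ Finset.Icc 1 n, ((j : ℝ) * (1 / W)) ^ (1 - β) *
    (1 / √(1 + ((j : ℝ) * (1 / W)) ^ 2) ^ 3)
  have hWb : (W : ℝ) ^ (1 + β) = W * (W : ℝ) ^ β := by rw [Real.rpow_add hW0, Real.rpow_one]
  have hNb : (a * N : ℝ) ^ (1 + β) = a ^ (1 + β) * (N * (N : ℝ) ^ β) := by
    rw [Real.mul_rpow ha.le hN0.le, Real.rpow_add hN0, Real.rpow_one]
  have hWN : ((W : ℝ) / N) ^ β = (W : ℝ) ^ β / (N : ℝ) ^ β := Real.div_rpow hW0.le hN0.le _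
  have h1 : |T / W - h₀ * (W : ℝ) ^ β * P| ≤
      K * M * (k * W) ^ 2 + 2 * h₀ / a ^ (1 + β) * ((W : ℝ) / N) ^ β := by
    have e : T / W - h₀ * (W : ℝ) ^ β * P = (T - h₀ * (W : ℝ) ^ (1 + β) * P) / W := by
      rw [hWb]; field_simp
    rw [e, abs_div, abs_of_pos hW0, div_le_iff₀ hW0]
    refine hsum.trans ?_
    rw [add_mul]
    refine add_le_add ?_ ?_
    · rw [one_div, inv_mul_le_iff₀ hW0] at hR
      calc _ ≤ K * (k * W) ^ 2 * (W * M) := by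
            gcongr
        _ = _ := by ring
    · have hnN : (n : ℝ) ≤ N := by exact_mod_cast (by omega : n ≤ N)
      calc (n : ℝ) * (2 * h₀ * (W : ℝ) ^ (1 + β) / (a * N) ^ (1 + β))
          ≤ N * (2 * h₀ * (W : ℝ) ^ (1 + β) / (a * N) ^ (1 + β)) := by gcongr
        _ = _ := by rw [hWb, hNb, hWN]; field_simp
  have h2 : |h₀ * (W : ℝ) ^ β * P - h₀ * tailConst β * |k * W| ^ β| ≤
      h₀ * C * (k * W) ^ 2 + h₀ * C * 4 ^ β * ((W : ℝ) / N) ^ β := by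
    have e : h₀ * (W : ℝ) ^ β * P - h₀ * tailConst β * |k * W| ^ β
        = h₀ * (W : ℝ) ^ β * (P - |k| ^ β * tailConst β) := by
      rw [abs_mul, abs_of_pos hW0, Real.mul_rpow (abs_nonneg k) hW0.le]; ring
    rw [e, abs_mul, abs_of_nonneg (by positivity)]
    -- The lattice error `k² W^β` is absorbed into `(kW)²`.
    have e1 : (W : ℝ) ^ β ≤ (W : ℝ) ^ 2 := by
      rw [← Real.rpow_natCast]
      exact Real.rpow_le_rpow_of_exponent_le hW1 (by push_cast; linarith)
    have e2 : (n : ℝ) ^ (-β) ≤ 4 ^ β / (N : ℝ) ^ β := by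
      have : (N : ℝ) / 4 ≤ n := by
        rw [div_le_iff₀ (by norm_num)]; exact_mod_cast (by omega : N ≤ n * 4)
      calc (n : ℝ) ^ (-β) ≤ ((N : ℝ) / 4) ^ (-β) :=
            Real.rpow_le_rpow_of_nonpos (by positivity) this (by linarith)
        _ = _ := by rw [Real.rpow_neg (by positivity), Real.div_rpow hN0.le (by norm_num), inv_div]
    calc _ ≤ h₀ * (W : ℝ) ^ β * (C * (k ^ 2 + (n : ℝ) ^ (-β))) := by gcongr; exact hC1 k n hn0
      _ = h₀ * C * ((W : ℝ) ^ β * k ^ 2) + h₀ * C * (W : ℝ) ^ β * (n : ℝ) ^ (-β) := by ring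
      _ ≤ h₀ * C * ((W : ℝ) ^ 2 * k ^ 2) + h₀ * C * (W : ℝ) ^ β * (4 ^ β / (N : ℝ) ^ β) := by
          gcongr
      _ = _ := by rw [hWN]; ring
  have hp1 : 0 ≤ K * M * ((W : ℝ) / N) ^ β := by positivity
  have hp2 : 0 ≤ 2 * h₀ / a ^ (1 + β) * (k * W) ^ 2 := by positivity
  have hp3 : 0 ≤ h₀ * C * ((W : ℝ) / N) ^ β := by positivity
  have hp4 : 0 ≤ h₀ * C * 4 ^ β * (k * W) ^ 2 := by positivity
  have h3 := abs_add_le (T / W - h₀ * (W : ℝ) ^ β * P)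
    (h₀ * (W : ℝ) ^ β * P - h₀ * tailConst β * |k * W| ^ β)
  rw [sub_add_sub_cancel] at h3
  refine h3.trans ((add_le_add h1 h2).trans ?_)
  linarith

/-- The symbol `Z (1 - Ŝ)` at frequency `p`. -/
theorem normConst_sub_circEig (f σ : ℝ → ℝ) (N W : ℕ) [NeZero N] (p : ZMod N) :
    normConst f σ N W - circEig (weight f σ N W) p = ∑ u : ZMod N,
      f ((rep u : ℝ) / W) * σ ((rep u : ℝ) / N) *
        (1 - Real.cos (2 * Real.pi * rep p / N * rep u)) := by
  rw [normConst, circEig, ← Finset.sum_sub_distrib]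
  refine Finset.sum_congr rfl fun u _ => ?_
  rw [circCos_eq, weight]; ring

theorem normConst_sub_circEig_eq (hf : IsHeavyTailedDensity β h₀ f) (hσ : IsCutoff σ) (N W : ℕ)
    [NeZero N] (p : ZMod N) :
    normConst f σ N W - circEig (weight f σ N W) p =
      ∑ j ∈ Finset.Icc 1 ((N - 1) / 2), f (j / W) * σ (j / N) *
        (1 - Real.cos (2 * Real.pi * rep p / N * j)) +
      ∑ j ∈ Finset.Icc 1 (N / 2), f (j / W) * σ (j / N) *
        (1 - Real.cos (2 * Real.pi * rep p / N * j)) := by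
  rw [normConst_sub_circEig]
  rw [sum_rep_eq (fun j : ℤ => f ((j : ℝ) / W) * σ ((j : ℝ) / N) *
        (1 - Real.cos (2 * Real.pi * rep p / N * j))) fun j => by
    push_cast
    rw [neg_div, neg_div, hf.symm, hσ.symm, mul_neg, Real.cos_neg]]
  simp

theorem normConst_eq (hf : IsHeavyTailedDensity β h₀ f) (hσ : IsCutoff σ) (N W : ℕ) [NeZero N] :
    normConst f σ N W = f 0 * σ 0 + ∑ j ∈ Finset.Icc 1 ((N - 1) / 2), f (j / W) * σ (j / N) +
      ∑ j ∈ Finset.Icc 1 (N / 2), f (j / W) * σ (j / N) := by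
  have h := sum_rep_eq (N := N) (fun j : ℤ => f ((j : ℝ) / W) * σ ((j : ℝ) / N)) fun j => by
    push_cast
    rw [neg_div, neg_div, hf.symm, hσ.symm]
  simp only [Int.cast_zero, zero_div, Int.cast_natCast] at h
  exact h

/-- The momentum variable `q = 2π p W / N`. -/
def momentum (N W : ℕ) (p : ZMod N) : ℝ := rep p * (2 * Real.pi * W / N)

set_option maxHeartbeats 800000 in
/-- Upper and lower bounds for the symbol of the band matrix. -/
theorem exists_symbol_bounds (hβ₁ : 1 < β) (hβ₂ : β < 2) (h0 : 0 < h₀)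
    (hf : IsHeavyTailedDensity β h₀ f) (hσ : IsCutoff σ) :
    ∃ K q₀ c ε : ℝ, 0 < K ∧ 0 < q₀ ∧ 0 < c ∧ 0 < ε ∧
      (∀ q : ℝ, |q| ≤ q₀ → K * q ^ 2 ≤ h₀ * tailConst β * |q| ^ β) ∧
      ∀ (N W : ℕ) [NeZero N], 1 ≤ W → (W : ℝ) ≤ ε * N →
        c * W ≤ normConst f σ N W ∧ normConst f σ N W ≤ K * W ∧
        (∀ u, weight f σ N W u ≤ K) ∧
        ∀ p : ZMod N,
          |(normConst f σ N W - circEig (weight f σ N W) p) / W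
            - h₀ * (2 * tailConst β) * |momentum N W p| ^ β|
              ≤ K * (momentum N W p ^ 2 + ((W : ℝ) / N) ^ β) ∧
          (q₀ ≤ |momentum N W p| →
            c * W ≤ normConst f σ N W - circEig (weight f σ N W) p) := by
  obtain ⟨C₁, hC₁, hs⟩ := exists_half_symbol_bound hβ₁ hβ₂ h0 hf hσ
  obtain ⟨K₂, hK₂, hfK⟩ := hf.exists_le_div h0 hβ₁
  obtain ⟨Y₀, hY₀, hfY⟩ := hf.exists_div_le h0
  obtain ⟨a, b, ha, hab, hb, hσa, hσb⟩ := hσ.bump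
  have ht := tailConst_pos hβ₁ hβ₂
  have hG := greenConst_nonneg β
  set K : ℝ := 2 * C₁ + K₂ * (1 + 2 * greenConst β) with hK
  have hK0 : 0 < K := by positivity
  -- Below `q₀` the error `K q²` is at most half of the leading term `2 h₀ tailConst β |q|^β`.
  set q₀ : ℝ := (h₀ * tailConst β / K) ^ (1 / (2 - β)) with hq₀
  have hq0 : 0 < q₀ := by positivity
  -- The block `YW < j ≤ 2YW` lies in the power-law regime of `f`, and `Y ≥ 1 + 8/q₀` leaves a
  -- surplus after the cosine sum `8/|k| ≤ (8/q₀) W` is subtracted.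
  obtain ⟨Y, hY⟩ := exists_nat_ge (max Y₀ (1 + 8 / q₀))
  have hY1 : Y₀ ≤ Y := (le_max_left _ _).trans hY
  have hY2 : 1 + 8 / q₀ ≤ Y := (le_max_right _ _).trans hY
  have hYp : (0 : ℝ) < Y := hY₀.trans_le hY1
  have hY1' : (1 : ℝ) ≤ Y := by
    have : 0 < 8 / q₀ := by positivity
    linarith
  set c : ℝ := h₀ / 2 / (2 * Y) ^ (1 + β) with hc
  have hc0 : 0 < c := by positivity
  have hKK : K₂ ≤ K := by
    have : 0 ≤ K₂ * (2 * greenConst β) := by positivity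
    rw [hK]; linarith
  have hfK' : ∀ x, f x ≤ K₂ := fun x => (hfK x).trans (div_le_self hK₂.le (by
    have : 0 ≤ |x| ^ β := by positivity
    linarith))
  -- This `ε` puts the whole block where `σ = 1` and inside half of the torus.
  refine ⟨K, q₀, c, a / (4 * Y), hK0, hq0, hc0, by positivity, ?_, fun N W _ hW hWN => ?_⟩
  · intro q hq
    rcases eq_or_ne q 0 with rfl | hq1
    · rw [abs_zero, Real.zero_rpow (by linarith)]; simp
    have hqp : 0 < |q| := abs_pos.2 hq1
    have e1 : |q| ^ (2 - β) ≤ h₀ * tailConst β / K := by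
      calc |q| ^ (2 - β) ≤ q₀ ^ (2 - β) := Real.rpow_le_rpow hqp.le hq (by linarith)
        _ = _ := by
          rw [hq₀, ← Real.rpow_mul (by positivity), one_div_mul_cancel (by linarith),
            Real.rpow_one]
    rw [le_div_iff₀ hK0] at e1
    have e2 : q ^ 2 = |q| ^ (2 - β) * |q| ^ β := by
      rw [← Real.rpow_add hqp, sub_add_cancel, ← sq_abs, ← Real.rpow_natCast]; norm_num
    rw [e2]
    have : 0 ≤ |q| ^ β := by positivity
    nlinarith
  have hW0 : (0 : ℝ) < W := by exact_mod_cast hW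
  have hW1 : (1 : ℝ) ≤ W := by exact_mod_cast hW
  have hWN' : 4 * Y * W ≤ a * N := by
    rw [div_mul_eq_mul_div, le_div_iff₀ (by positivity)] at hWN; linarith
  have hN0 : (0 : ℝ) < N := by
    by_contra hc
    push Not at hc
    have : 0 < 4 * (Y : ℝ) * W := by positivity
    nlinarith
  have hN3 : 3 ≤ N := by
    have h1 : (8 : ℝ) ≤ N := by nlinarith
    have : 8 ≤ N := by exact_mod_cast h1
    omega
  have hpart : ∀ (k : ℕ → ℝ), (∀ j, 0 ≤ k j) →
      c * ∑ j ∈ Finset.Ioc (Y * W) (2 * (Y * W)), k j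
        ≤ ∑ j ∈ Finset.Icc 1 (N / 2), f (j / W) * σ (j / N) * k j := by
    intro k hk
    rw [Finset.mul_sum]
    have hsub : Finset.Ioc (Y * W) (2 * (Y * W)) ⊆ Finset.Icc 1 (N / 2) := by
      intro j hj
      rw [Finset.mem_Ioc] at hj
      rw [Finset.mem_Icc]
      have h1 : 4 * (Y * W) ≤ N := by
        have : (4 * (Y * W) : ℝ) ≤ N := by nlinarith
        exact_mod_cast this
      omega
    refine le_trans (Finset.sum_le_sum fun j hj => ?_)
      (Finset.sum_le_sum_of_subset_of_nonneg hsub fun j _ _ =>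
        mul_nonneg (mul_nonneg (hf.nonneg _) (hσ.nonneg _)) (hk j))
    rw [Finset.mem_Ioc] at hj
    have j1 : (Y * W : ℝ) < j := by exact_mod_cast hj.1
    have j2 : (j : ℝ) ≤ 2 * (Y * W) := by exact_mod_cast hj.2
    have hx1 : (Y : ℝ) ≤ j / W := by rw [le_div_iff₀ hW0]; exact j1.le
    have hx2 : (j : ℝ) / W ≤ 2 * Y := by rw [div_le_iff₀ hW0]; linarith
    have hx0 : (0 : ℝ) < j / W := hYp.trans_le hx1
    rw [hσa (j / N) (by
      rw [abs_of_nonneg (by positivity), div_le_iff₀ hN0]; linarith), mul_one]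
    refine mul_le_mul_of_nonneg_right ?_ (hk j)
    refine le_trans ?_ (hfY _ (hY1.trans hx1))
    rw [hc]
    gcongr
  have hcard : ∑ j ∈ Finset.Ioc (Y * W) (2 * (Y * W)), (1 : ℝ) = Y * W := by
    rw [Finset.sum_const, Nat.card_Ioc, nsmul_eq_mul, mul_one, two_mul, Nat.add_sub_cancel]
    push_cast; ring
  have hnn : ∀ (n : ℕ) (k : ℕ → ℝ), (∀ j, 0 ≤ k j) →
      0 ≤ ∑ j ∈ Finset.Icc 1 n, f (j / W) * σ (j / N) * k j := fun n k hk =>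
    Finset.sum_nonneg fun j _ => mul_nonneg (mul_nonneg (hf.nonneg _) (hσ.nonneg _)) (hk j)
  refine ⟨?_, ?_, ?_, fun p => ⟨?_, ?_⟩⟩
  · rw [normConst_eq hf hσ]
    have h1 := hpart (fun _ => 1) fun _ => zero_le_one
    have h2 := hnn ((N - 1) / 2) (fun _ => 1) fun _ => zero_le_one
    simp only [mul_one] at h1 h2
    rw [hcard] at h1
    have h3 : 0 ≤ f 0 * σ 0 := mul_nonneg (hf.nonneg _) (hσ.nonneg _)
    have h4 : c * W ≤ c * (Y * W) := by gcongr; nlinarith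
    linarith
  · rw [normConst_eq hf hσ]
    have hsum : ∀ n : ℕ, ∑ j ∈ Finset.Icc 1 n, f (j / W) * σ (j / N)
        ≤ K₂ * greenConst β * W := by
      intro n
      have e := mul_sum_le_integral_Ioi (F := fun q => 1 / (1 + 1 * |q| ^ β))
        ((antitoneOn_one_div_add_rpow hβ₁ zero_lt_one zero_le_one).mono Set.Ioi_subset_Ici_self)
        (fun x _ => by positivity) (integrableOn_one_div_add_rpow hβ₁ zero_lt_one zero_lt_one)
        (one_div_pos.2 hW0) n
      simp only [one_mul] at e
      rw [← greenConst, one_div_mul_eq_div, div_le_iff₀ hW0] at e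
      have e2 : ∑ j ∈ Finset.Icc 1 n, f (j / W) * σ (j / N)
          ≤ ∑ j ∈ Finset.Icc 1 n, K₂ * (1 / (1 + |(j : ℝ) * (1 / W)| ^ β)) := by
        refine Finset.sum_le_sum fun j _ => ?_
        rw [mul_one_div, mul_one_div]
        exact (mul_le_of_le_one_right (hf.nonneg _) (hσ.le_one _)).trans (hfK _)
      rw [← Finset.mul_sum] at e2
      nlinarith
    have h1 := hsum ((N - 1) / 2)
    have h2 := hsum (N / 2)
    have h3 : f 0 * σ 0 ≤ K₂ := (mul_le_of_le_one_right (hf.nonneg _) (hσ.le_one _)).trans (hfK' _)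
    have h4 : 0 ≤ C₁ * W := by positivity
    rw [hK]
    nlinarith
  · intro u
    exact ((mul_le_of_le_one_right (hf.nonneg _) (hσ.le_one _)).trans (hfK' _)).trans hKK
  · rw [normConst_sub_circEig_eq hf hσ]
    have hq : 2 * Real.pi * rep p / N * W = momentum N W p := by rw [momentum]; ring
    have h1 := hs N W ((N - 1) / 2) (2 * Real.pi * rep p / N) hW (by omega) (by omega) (by omega)
    have h2 := hs N W (N / 2) (2 * Real.pi * rep p / N) hW (by omega) (by omega) (by omega)
    rw [hq] at h1 h2
    have h3 : 0 ≤ K₂ * (1 + 2 * greenConst β) * (momentum N W p ^ 2 + ((W : ℝ) / N) ^ β) := by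
      positivity
    rw [add_div]
    rw [abs_le] at h1 h2 ⊢
    rw [hK]
    constructor <;> linarith
  · intro hqp
    rw [normConst_sub_circEig_eq hf hσ]
    set k : ℝ := 2 * Real.pi * rep p / N with hk
    have hq : k * W = momentum N W p := by rw [hk, momentum]; ring
    have h1 := hpart (fun j => 1 - Real.cos (k * j)) fun _ => one_sub_cos_nonneg _
    have h2 := hnn ((N - 1) / 2) (fun j => 1 - Real.cos (k * j)) fun _ => one_sub_cos_nonneg _
    rw [Finset.sum_sub_distrib, hcard] at h1
    have hk0 : k ≠ 0 := by
      rintro h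
      rw [← hq, h, zero_mul, abs_zero] at hqp
      linarith
    have hkpi : |k| ≤ Real.pi := by
      obtain ⟨r1, r2, -⟩ := rep_spec p
      have r1' : -(N : ℝ) ≤ 2 * rep p := by exact_mod_cast r1
      have r2' : (2 * rep p : ℝ) ≤ N := by exact_mod_cast r2.le
      rw [hk, abs_le]
      constructor
      · rw [le_div_iff₀ hN0]; nlinarith [Real.pi_pos]
      · rw [div_le_iff₀ hN0]; nlinarith [Real.pi_pos]
    have h3 := (abs_le.1 (abs_sum_Ioc_cos_le hk0 hkpi (by omega : Y * W ≤ 2 * (Y * W)))).2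
    have h4 : 8 / |k| ≤ 8 / q₀ * W := by
      rw [← hq, abs_mul, abs_of_pos hW0] at hqp
      rw [div_mul_eq_mul_div, div_le_div_iff₀ (abs_pos.2 hk0) hq0]
      linarith
    have h5 : c * W ≤ c * (Y * W - ∑ j ∈ Finset.Ioc (Y * W) (2 * (Y * W)), Real.cos (k * j)) := by
      gcongr
      have : ∀ j : ℕ, k * j = j * k := fun j => mul_comm _ _
      simp_rw [this]
      have h6 := mul_le_mul_of_nonneg_right hY2 hW0.le
      linarith
    linarith

end Symbol

/-! ### Pointwise comparison of the resolvent multiplier with its limit. -/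

section Resolvent

/-- Comparison of the resolvent symbol with its small-momentum limit `t / (α η + B u)`. -/
theorem abs_resolvent_sub_le {b C₂ B₁ K' t a B u s η ν ρ α : ℝ} (hb : 0 < b) (hC₂ : 1 ≤ C₂)
    (hK' : 0 < K')
    (hB₀ : b ≤ B) (hB₁ : B ≤ B₁) (hu : 0 ≤ u) (hη : 0 < η) (hη1 : C₂ * η ≤ 1 / 4) (hα : 1 ≤ α)
    (hαC : α ≤ C₂) (ht : t < 1) (htα : |1 - t - α * η| ≤ C₂ * η ^ 2) (ha : |a| ≤ 1)
    (hν : 0 ≤ ν)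
    (hρν : ρ ≤ ν * η) (hνK : K' * ν ≤ 1 / 4) (hs : 0 ≤ s) (hsu : K' * s ≤ B / 2 * u)
    (h : |1 - a - B * u| ≤ K' * (s + ρ)) :
    0 < 1 - t * a ∧ |(t * a) ^ 2 / (1 - t * a) - t / (α * η + B * u)| ≤
      (2 + 2 * C₂ / min (1 / 2) (b / 4) + (C₂ + K' + 2 * C₂ * B₁) / min (1 / 2) (b / 4) ^ 2) *
        (1 + s / (η + u) ^ 2 + ν / (η + u)) := by
  set c₃ := min (1 / 2) (b / 4) with hc₃
  have hc0 : 0 < c₃ := by positivity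
  have hc1 : c₃ ≤ 1 / 2 := min_le_left _ _
  have hc2 : c₃ ≤ b / 4 := min_le_right _ _
  set G := η + u with hG
  have hG0 : 0 < G := by positivity
  have hBu : b * u ≤ B * u := by gcongr
  have hBu1 : B * u ≤ B₁ * u := by gcongr
  rw [abs_le] at htα h ha
  have hBu0 : 0 ≤ B * u := (mul_nonneg hb.le hu).trans hBu
  have hη2 : C₂ * η ^ 2 ≤ η / 4 := by
    have := mul_le_mul_of_nonneg_right hη1 hη.le
    linarith
  have hαη : η ≤ α * η := le_mul_of_one_le_left hη.le hα
  have hαη' : α * η ≤ C₂ * η := mul_le_mul_of_nonneg_right hαC hη.le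
  have hCη : η ≤ C₂ * η := le_mul_of_one_le_left hη.le hC₂
  have h1t : 1 - t ≤ 2 * C₂ * η := by linarith
  have ht2 : 1 / 2 ≤ t := by linarith
  have hKρ : K' * ρ ≤ η / 4 := by
    have e1 := mul_le_mul_of_nonneg_left hρν hK'.le
    have e2 := mul_le_mul_of_nonneg_right hνK hη.le
    linarith
  have hcG : c₃ * G ≤ η / 2 + b / 4 * u := by
    have e1 := mul_le_mul_of_nonneg_right hc1 hη.le
    have e2 := mul_le_mul_of_nonneg_right hc2 hu
    rw [hG]; linarith
  -- Both denominators dominate `G = η + u`: the errors use up at most half of `Bu` and a fraction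
  -- of `η`.
  have hD : c₃ * G ≤ 1 - t * a := by
    have e1 : B / 2 * u - η / 4 ≤ 1 - a := by linarith
    have e2 : t * (B / 2 * u - η / 4) ≤ t * (1 - a) := by gcongr
    have e3 : 1 / 2 * (B / 2 * u) ≤ t * (B / 2 * u) := by
      refine mul_le_mul_of_nonneg_right ht2 ?_
      linarith
    have e4 : t * (η / 4) ≤ η / 4 := mul_le_of_le_one_left (by linarith) ht.le
    linarith
  have hA : c₃ * G ≤ α * η + B * u := by linarith
  have hD0 : 0 < 1 - t * a := lt_of_lt_of_le (by positivity) hD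
  have hA0 : 0 < α * η + B * u := lt_of_lt_of_le (by positivity) hA
  refine ⟨hD0, ?_⟩
  have hB1 : 0 < B₁ := by linarith
  have hdiff : |(α * η + B * u) - (1 - t * a)| ≤
      (C₂ + K' + 2 * C₂ * B₁) * (η * G + s + ν * η) := by
    have e0 : (α * η + B * u) - (1 - t * a)
        = -(1 - t - α * η) - t * (1 - a - B * u) + (1 - t) * (B * u) := by ring
    have f1 : |t * (1 - a - B * u)| ≤ K' * (s + ν * η) := by
      rw [abs_mul, abs_of_pos (by linarith)]
      have : |1 - a - B * u| ≤ K' * (s + ν * η) := (abs_le.2 h).trans (by gcongr)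
      exact (mul_le_of_le_one_left (abs_nonneg _) ht.le).trans this
    have f2 : |(1 - t) * (B * u)| ≤ 2 * C₂ * B₁ * (η * G) := by
      rw [abs_of_nonneg (mul_nonneg (by linarith) hBu0)]
      calc _ ≤ 2 * C₂ * η * (B₁ * G) := by
            refine mul_le_mul h1t (hBu1.trans ?_) hBu0 (by positivity)
            gcongr; linarith
        _ = _ := by ring
    have f3 : |1 - t - α * η| ≤ C₂ * (η * G) := by
      refine (abs_le.2 htα).trans ?_
      gcongr
      rw [hG, sq]
      gcongr
      linarith
    have g1 : 0 ≤ η * G := by positivity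
    have g2 : 0 ≤ ν * η := by positivity
    have p1 : 0 ≤ C₂ * (s + ν * η) := by positivity
    have p2 : 0 ≤ K' * (η * G) := by positivity
    have p3 : 0 ≤ 2 * C₂ * B₁ * (s + ν * η) := by positivity
    rw [e0]
    refine (abs_add_le _ _).trans ((add_le_add (abs_sub _ _) le_rfl).trans ?_)
    rw [abs_neg]
    linarith
  have hne1 := hD0.ne'
  have hne2 := hA0.ne'
  -- From `(ta)²/(1 - ta) = 1/(1 - ta) - (1 + ta)`. The last two terms of the decomposition are
  -- bounded, so only the difference of the denominators matters.
  have hdec : (t * a) ^ 2 / (1 - t * a) - t / (α * η + B * u)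
      = ((α * η + B * u) - (1 - t * a)) / ((1 - t * a) * (α * η + B * u))
        + (1 - t) / (α * η + B * u) - (1 + t * a) := by
    field_simp
    ring
  have k1 : |((α * η + B * u) - (1 - t * a)) / ((1 - t * a) * (α * η + B * u))|
      ≤ (C₂ + K' + 2 * C₂ * B₁) / c₃ ^ 2 * (1 + s / G ^ 2 + ν / G) := by
    rw [abs_div, abs_of_pos (mul_pos hD0 hA0)]
    calc _ ≤ (C₂ + K' + 2 * C₂ * B₁) * (η * G + s + ν * η) / ((c₃ * G) * (c₃ * G)) := by gcongr
      _ ≤ (C₂ + K' + 2 * C₂ * B₁) * (G * G + s + ν * G) / ((c₃ * G) * (c₃ * G)) := by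
          have : η ≤ G := by linarith
          gcongr
      _ = _ := by field_simp
  have k2 : |(1 - t) / (α * η + B * u)| ≤ 2 * C₂ / c₃ := by
    rw [abs_of_nonneg (div_nonneg (by linarith) hA0.le)]
    calc _ ≤ 2 * C₂ * η / (c₃ * η) := by
          have : c₃ * η ≤ c₃ * G := by gcongr; linarith
          gcongr
          linarith
      _ = _ := by field_simp
  have k3 : |1 + t * a| ≤ 2 := by
    have : |t * a| ≤ 1 := by
      rw [abs_mul, abs_of_pos (by linarith)]
      exact mul_le_one₀ ht.le (abs_nonneg a) (abs_le.2 ha)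
    rw [abs_le] at this ⊢
    constructor <;> linarith
  rw [hdec]
  refine (abs_sub _ _).trans ((add_le_add ((abs_add_le _ _).trans (add_le_add k1 k2)) k3).trans ?_)
  have m1 : 0 ≤ s / G ^ 2 + ν / G := by positivity
  have m2 : 0 ≤ (2 + 2 * C₂ / c₃) * (s / G ^ 2 + ν / G) := by positivity
  linarith

variable {β : ℝ}

/-- Below `r` the factor `y^(2-β)` is small; above `r` it is merely bounded, but `η` can be dropped
and `r^β` inserted in the denominator. The free scale `r` avoids separate treatment of `β` above and
below `3/2`. -/
theorem sq_div_add_rpow_sq_le (hβ₁ : 1 < β) (hβ₂ : β < 2) {y η r q₀ : ℝ} (hy : 0 ≤ y) (hη : 0 < η)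
    (hr : 0 < r) (hq : y ≤ q₀) :
    y ^ 2 / (η + y ^ β) ^ 2 ≤ r ^ (2 - β) / (η + y ^ β)
      + 2 * q₀ ^ (2 - β) * (1 / (r ^ β + y ^ β)) := by
  rcases hy.eq_or_lt with rfl | hy0
  · rw [zero_pow two_ne_zero, zero_div]
    have : (0 : ℝ) ≤ 0 ^ β := by rw [Real.zero_rpow (by linarith)]
    positivity
  have hq0 : 0 < q₀ := hy0.trans_le hq
  have e : y ^ 2 = y ^ (2 - β) * y ^ β := by
    rw [← Real.rpow_add hy0, sub_add_cancel, ← Real.rpow_natCast]; norm_num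
  have hu : 0 < y ^ β := by positivity
  rcases le_or_gt y r with h | h
  · have e1 : y ^ (2 - β) ≤ r ^ (2 - β) := Real.rpow_le_rpow hy h (by linarith)
    have : 0 ≤ 2 * q₀ ^ (2 - β) * (1 / (r ^ β + y ^ β)) := by positivity
    have e2 : y ^ 2 / (η + y ^ β) ^ 2 ≤ r ^ (2 - β) / (η + y ^ β) := by
      rw [e, div_le_div_iff₀ (by positivity) (by positivity)]
      calc _ ≤ r ^ (2 - β) * (η + y ^ β) * (η + y ^ β) := by gcongr; linarith
        _ = _ := by ring
    linarith
  · have e1 : y ^ (2 - β) ≤ q₀ ^ (2 - β) := Real.rpow_le_rpow hy hq (by linarith)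
    have e2 : r ^ β ≤ y ^ β := Real.rpow_le_rpow hr.le h.le (by linarith)
    have : 0 ≤ r ^ (2 - β) / (η + y ^ β) := by positivity
    have e3 : y ^ 2 / (η + y ^ β) ^ 2 ≤ 2 * q₀ ^ (2 - β) * (1 / (r ^ β + y ^ β)) := by
      rw [e, mul_one_div, div_le_div_iff₀ (by positivity) (by positivity)]
      calc _ ≤ q₀ ^ (2 - β) * y ^ β * (y ^ β + y ^ β) := by gcongr
        _ = 2 * q₀ ^ (2 - β) * (y ^ β) ^ 2 := by ring
        _ ≤ _ := by gcongr; linarith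
    linarith

/-- For `y ≤ q₀` this is the comparison of denominators. For `y ≥ q₀` the gap bounds the exact
multiplier by a multiple of `a²`, and the limiting one is `O(1/(1 + y^β))`. Each of the four terms
has a computable lattice average. -/
theorem exists_resolvent_symbol_bound (hβ₁ : 1 < β) (hβ₂ : β < 2) {K q₀ c h C₂ : ℝ} (hK : 0 < K)
    (hq₀ : 0 < q₀) (hc : 0 < c) (hh : 0 < h) (hC₂ : 1 ≤ C₂) :
    ∃ C : ℝ, 0 < C ∧ ∀ t a w y η ν ρ α r : ℝ, 1 / K ≤ w → w ≤ 1 / c → 0 ≤ y → 0 < r → 0 < η →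
      C₂ * η ≤ 1 / 4 → 1 ≤ α → α ≤ C₂ → t < 1 → |1 - t - α * η| ≤ C₂ * η ^ 2 → |a| ≤ 1 →
      0 ≤ ν → ρ ≤ ν * η → K / c * ν ≤ 1 / 4 →
      |1 - a - h * 2 * w * y ^ β| ≤ w * (K * (y ^ 2 + ρ)) →
      (y ≤ q₀ → K * y ^ 2 ≤ h * y ^ β) → (q₀ ≤ y → c * w ≤ 1 - a) →
      0 < 1 - t * a ∧
      |(t * a) ^ 2 / (1 - t * a) - t / (α * η + h * 2 * w * y ^ β)| ≤
        C * (1 / (1 + y ^ β) + (ν + r ^ (2 - β)) * (1 / (η + y ^ β)) + 1 / (r ^ β + y ^ β)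
          + a ^ 2) := by
  set b := h * 2 * (1 / K) with hb
  set B₁ := h * 2 * (1 / c) with hB₁
  set K' := K / c with hK'
  have hb0 : 0 < b := by positivity
  have hB₁0 : 0 < B₁ := by positivity
  have hK'0 : 0 < K' := by positivity
  set C₅ := 2 + 2 * C₂ / min (1 / 2) (b / 4) + (C₂ + K' + 2 * C₂ * B₁) / min (1 / 2) (b / 4) ^ 2
    with hC₅
  have hC₅0 : 0 < C₅ := by positivity
  have hq0b : 0 < q₀ ^ β := by positivity
  refine ⟨C₅ * (1 + q₀ ^ β) + C₅ + C₅ * (2 * q₀ ^ (2 - β)) + 2 * K / c + 1 / b * (1 / q₀ ^ β + 1),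
    by positivity, ?_⟩
  intro t a w y η ν ρ α r hw1 hw2 hy hr hη hη1 hα hαC ht htα ha hν hρν hνK hsym hlow hhigh
  have hw0 : 0 < w := lt_of_lt_of_le (by positivity) hw1
  have hu : 0 ≤ y ^ β := Real.rpow_nonneg hy β
  set u := y ^ β with hud
  have hrb : 0 < r ^ β := by positivity
  have hr2 : 0 < r ^ (2 - β) := by positivity
  have hX1 : 0 ≤ 1 / (1 + u) := by positivity
  have hX2 : 0 ≤ (ν + r ^ (2 - β)) * (1 / (η + u)) := by positivity
  have hX3 : 0 ≤ 1 / (r ^ β + u) := by positivity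
  have hX4 : 0 ≤ a ^ 2 := sq_nonneg a
  have hbB : b ≤ h * 2 * w := by rw [hb]; gcongr
  have hBB : h * 2 * w ≤ B₁ := by rw [hB₁]; gcongr
  have hwK : w * K ≤ K' := by
    rw [hK']; calc w * K ≤ 1 / c * K := by gcongr
      _ = _ := by ring
  rcases le_or_gt y q₀ with hyq | hyq
  · have hsu : w * K * y ^ 2 ≤ h * 2 * w / 2 * u := by
      have := mul_le_mul_of_nonneg_left (hlow hyq) hw0.le
      linarith
    have hwν : w * K * ν ≤ 1 / 4 := le_trans (by gcongr) hνK
    obtain ⟨h1, h2⟩ := abs_resolvent_sub_le (b := b) (C₂ := C₂) (B₁ := B₁) (K' := w * K) (s := y ^ 2)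
      hb0 hC₂ (by positivity) hbB hBB hu hη hη1 hα hαC ht htα ha hν hρν hwν (sq_nonneg y) hsu
      (by rw [mul_assoc w]; exact hsym)
    refine ⟨h1, h2.trans ?_⟩
    have h3 : 2 + 2 * C₂ / min (1 / 2) (b / 4) +
        (C₂ + w * K + 2 * C₂ * B₁) / min (1 / 2) (b / 4) ^ 2 ≤ C₅ := by
      rw [hC₅]; gcongr
    have h4 := sq_div_add_rpow_sq_le hβ₁ hβ₂ hy hη hr hyq
    rw [← hud] at h4
    have h5 : 1 ≤ (1 + q₀ ^ β) * (1 / (1 + u)) := by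
      rw [mul_one_div, le_div_iff₀ (by positivity), one_mul]
      have : u ≤ q₀ ^ β := Real.rpow_le_rpow hy hyq (by linarith)
      linarith
    have h6 : 1 + y ^ 2 / (η + u) ^ 2 + ν / (η + u) ≤ (1 + q₀ ^ β) * (1 / (1 + u)) +
        (ν + r ^ (2 - β)) * (1 / (η + u)) + 2 * q₀ ^ (2 - β) * (1 / (r ^ β + u)) := by
      have : (ν + r ^ (2 - β)) * (1 / (η + u)) = ν / (η + u) + r ^ (2 - β) / (η + u) := by ring
      linarith
    have h7 : 0 ≤ 1 + y ^ 2 / (η + u) ^ 2 + ν / (η + u) := by positivity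
    calc _ ≤ C₅ * ((1 + q₀ ^ β) * (1 / (1 + u)) +
        (ν + r ^ (2 - β)) * (1 / (η + u)) + 2 * q₀ ^ (2 - β) * (1 / (r ^ β + u))) :=
          mul_le_mul h3 h6 h7 hC₅0.le
      _ = C₅ * (1 + q₀ ^ β) * (1 / (1 + u)) + C₅ * ((ν + r ^ (2 - β)) * (1 / (η + u)))
          + C₅ * (2 * q₀ ^ (2 - β)) * (1 / (r ^ β + u)) := by ring
      _ ≤ _ := by
          set Q := C₅ * (1 + q₀ ^ β) + C₅ + C₅ * (2 * q₀ ^ (2 - β)) + 2 * K / c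
            + 1 / b * (1 / q₀ ^ β + 1) with hQ
          have n1 : 0 ≤ C₅ * (1 + q₀ ^ β) := by positivity
          have n2 : 0 ≤ C₅ * (2 * q₀ ^ (2 - β)) := by positivity
          have n3 : 0 ≤ 2 * K / c := by positivity
          have n4 : 0 ≤ 1 / b * (1 / q₀ ^ β + 1) := by positivity
          have m1 : C₅ * (1 + q₀ ^ β) * (1 / (1 + u)) ≤ Q * (1 / (1 + u)) :=
            mul_le_mul_of_nonneg_right (by linarith) hX1
          have m2 : C₅ * ((ν + r ^ (2 - β)) * (1 / (η + u)))
            ≤ Q * ((ν + r ^ (2 - β)) * (1 / (η + u))) :=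
            mul_le_mul_of_nonneg_right (by linarith) hX2
          have m3 : C₅ * (2 * q₀ ^ (2 - β)) * (1 / (r ^ β + u)) ≤ Q * (1 / (r ^ β + u)) :=
            mul_le_mul_of_nonneg_right (by linarith) hX3
          have m4 : 0 ≤ Q * a ^ 2 := mul_nonneg (by linarith) hX4
          rw [mul_add, mul_add, mul_add]
          linarith
  · have h1a := hhigh hyq.le
    have hcK : c / K ≤ 1 - a := le_trans (by
      calc c / K = c * (1 / K) := by ring
        _ ≤ c * w := by gcongr) h1a
    rw [abs_le] at htα
    have hη2 : C₂ * η ^ 2 ≤ η / 4 := by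
      have := mul_le_mul_of_nonneg_right hη1 hη.le
      linarith
    have hαη' : α * η ≤ C₂ * η := mul_le_mul_of_nonneg_right hαC hη.le
    have hCη : η ≤ C₂ * η := le_mul_of_one_le_left hη.le hC₂
    have ht2 : 1 / 2 ≤ t := by linarith
    have hcK0 : 0 < c / K := by positivity
    have hD : c / (2 * K) ≤ 1 - t * a := by
      have : c / (2 * K) = 1 / 2 * (c / K) := by field_simp
      have h3 : 1 / 2 * (c / K) ≤ t * (1 - a) :=
        mul_le_mul ht2 hcK hcK0.le (by linarith)
      rw [this]
      linarith
    have hcK2 : 0 < c / (2 * K) := by positivity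
    have hD0 : 0 < 1 - t * a := hcK2.trans_le hD
    refine ⟨hD0, ?_⟩
    have k1 : (t * a) ^ 2 / (1 - t * a) ≤ 2 * K / c * a ^ 2 := by
      calc _ ≤ a ^ 2 / (c / (2 * K)) := by
            gcongr ?_ / ?_
            rw [mul_pow]
            exact mul_le_of_le_one_left hX4 (pow_le_one₀ (by linarith) ht.le)
        _ = _ := by field_simp
    have hy0 : 0 < y := hq₀.trans hyq
    have hu0 : 0 < u := by positivity
    have k2 : t / (α * η + h * 2 * w * u) ≤ 1 / b * (1 / q₀ ^ β + 1) * (1 / (1 + u)) := by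
      have e1 : t / (α * η + h * 2 * w * u) ≤ 1 / (b * u) := by
        have : b * u ≤ h * 2 * w * u := by gcongr
        have : 0 < α * η := by positivity
        gcongr
        linarith
      refine e1.trans ?_
      have e2 : q₀ ^ β ≤ u := Real.rpow_le_rpow hq₀.le hyq.le (by linarith)
      have e3 : 1 ≤ u / q₀ ^ β := by rwa [le_div_iff₀ hq0b, one_mul]
      rw [mul_one_div, div_le_div_iff₀ (by positivity) (by positivity)]
      have e4 : 1 / b * (1 / q₀ ^ β + 1) * (b * u) = u / q₀ ^ β + u := by field_simp
      rw [e4]; linarith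
    have p1 : 0 ≤ (t * a) ^ 2 / (1 - t * a) := by positivity
    have p2 : 0 ≤ t / (α * η + h * 2 * w * u) := by
      have : 0 < h * 2 * w := by positivity
      positivity
    have n1 : 0 ≤ C₅ * (1 + q₀ ^ β) := by positivity
    have n2 : 0 ≤ C₅ * (2 * q₀ ^ (2 - β)) := by positivity
    have n3 : 0 ≤ 2 * K / c := by positivity
    have n4 : 0 ≤ 1 / b * (1 / q₀ ^ β + 1) := by positivity
    set Q := C₅ * (1 + q₀ ^ β) + C₅ + C₅ * (2 * q₀ ^ (2 - β)) + 2 * K / c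
            + 1 / b * (1 / q₀ ^ β + 1) with hQ
    have m1 : 2 * K / c * a ^ 2 ≤ Q * a ^ 2 := mul_le_mul_of_nonneg_right (by linarith) hX4
    have m2 : 1 / b * (1 / q₀ ^ β + 1) * (1 / (1 + u)) ≤ Q * (1 / (1 + u)) :=
      mul_le_mul_of_nonneg_right (by linarith) hX1
    have hQ0 : 0 ≤ Q := by linarith
    have m3 := mul_nonneg hQ0 hX2
    have m4 := mul_nonneg hQ0 hX3
    rw [mul_add, mul_add, mul_add]
    refine (abs_sub _ _).trans ?_
    rw [abs_of_nonneg p1, abs_of_nonneg p2]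
    linarith

end Resolvent

/-! ### The limiting profile as an integral and as a lattice sum. -/

section LimitProfile

variable {β : ℝ}

theorem integrable_one_div_add_rpow (hβ₁ : 1 < β) {A B : ℝ} (hA : 0 < A) (hB : 0 < B) :
    Integrable (fun q : ℝ => 1 / (A + B * |q| ^ β)) := by
  have h := integrableOn_one_div_add_rpow hβ₁ hA hB
  rw [← integrableOn_univ, ← Set.Iic_union_Ioi (a := (0 : ℝ))]
  refine IntegrableOn.union ?_ h
  rw [integrableOn_Iic_iff_integrableOn_Iio]
  have h2 := IntegrableOn.comp_neg_Iio (c := 0) (f := fun q : ℝ => 1 / (A + B * |q| ^ β))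
    (by rwa [neg_zero])
  simpa using h2

theorem limitV_eq (hβ₁ : 1 < β) (x : ℝ) :
    limitV β x = ((1 / Real.pi * ∫ q in Set.Ioi (0 : ℝ), Real.cos (q * x) / (1 + q ^ β) : ℝ) : ℂ) := by
  set φ : ℝ → ℂ := fun q => Complex.exp (Complex.I * q * x) / ((1 + |q| ^ β : ℝ) : ℂ) with hφ
  have hpos : ∀ q : ℝ, 0 < 1 + |q| ^ β := fun q => by positivity
  have hcont : Continuous φ := by
    refine Continuous.div (by fun_prop) ?_ fun q => Complex.ofReal_ne_zero.2 (hpos q).ne'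
    exact Complex.continuous_ofReal.comp
      (continuous_const.add (continuous_abs.rpow_const fun _ => Or.inr (by linarith)))
  have hint : Integrable φ := by
    refine Integrable.mono' (integrable_one_div_add_rpow hβ₁ zero_lt_one zero_lt_one)
      hcont.aestronglyMeasurable (Filter.Eventually.of_forall fun q => ?_)
    have e : Complex.I * q * x = ((q * x : ℝ) : ℂ) * Complex.I := by push_cast; ring
    rw [norm_div, Complex.norm_real, Real.norm_of_nonneg (hpos q).le, e,
      Complex.norm_exp_ofReal_mul_I, one_mul]
  have hsum : ∀ q, φ q + φ (-q) = ((2 * (Real.cos (q * x) / (1 + |q| ^ β)) : ℝ) : ℂ) := by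
    intro q
    have e1 : Complex.I * q * x = ((q * x : ℝ) : ℂ) * Complex.I := by push_cast; ring
    have e2 : Complex.I * ((-q : ℝ) : ℂ) * x = -((q * x : ℝ) : ℂ) * Complex.I := by push_cast; ring
    simp only [hφ]
    rw [abs_neg, e1, e2, ← add_div, ← Complex.two_cos]
    push_cast
    ring
  have h2 : 2 * ∫ q, φ q = ((2 * ∫ q : ℝ, Real.cos (q * x) / (1 + |q| ^ β) : ℝ) : ℂ) := by
    rw [two_mul]
    nth_rewrite 2 [← integral_neg_eq_self]
    rw [← integral_add hint hint.comp_neg]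
    simp_rw [hsum]
    rw [integral_complex_ofReal, integral_const_mul]
  have h3 : ∫ q : ℝ, Real.cos (q * x) / (1 + |q| ^ β)
      = 2 * ∫ q in Set.Ioi (0 : ℝ), Real.cos (q * x) / (1 + q ^ β) := by
    rw [← integral_comp_abs (f := fun q => Real.cos (q * x) / (1 + q ^ β))]
    refine integral_congr_ae (Filter.Eventually.of_forall fun q => ?_)
    have : Real.cos (|q| * x) = Real.cos (q * x) := by
      rcases abs_choice q with h | h <;> rw [h]
      rw [neg_mul, Real.cos_neg]
    simp only [this]
  have h4 : ∫ q, φ q = ((∫ q : ℝ, Real.cos (q * x) / (1 + |q| ^ β) : ℝ) : ℂ) := by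
    have : (2 : ℂ) ≠ 0 := two_ne_zero
    refine mul_left_cancel₀ this ?_
    rw [h2]; push_cast; ring
  rw [limitV, h4, h3]
  generalize ∫ q in Set.Ioi (0 : ℝ), Real.cos (q * x) / (1 + q ^ β) = J
  push_cast
  have : (Real.pi : ℂ) ≠ 0 := by exact_mod_cast Real.pi_ne_zero
  field_simp

/-- The dilation `q ↦ (A/B)^(1/β) q` makes the two terms of the denominator `A + B q^β` proportional
to `1` and `q^β`. -/
theorem mul_limitV_eq (hβ₁ : 1 < β) {t A B W : ℝ} (hA : 0 < A) (hB : 0 < B) (X : ℝ) :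
    ((t / (W * A) * (A / B) ^ (1 / β) : ℝ) : ℂ) * limitV β ((A / B) ^ (1 / β) * X)
      = ((t * (1 / (Real.pi * W) *
        ∫ q in Set.Ioi (0 : ℝ), 1 / (A + B * |q| ^ β) * Real.cos (q * X)) : ℝ) : ℂ) := by
  rw [limitV_eq hβ₁, ← Complex.ofReal_mul]
  congr 1
  set l := (A / B) ^ (1 / β) with hl
  have hl0 : 0 < l := by positivity
  have hlb : l ^ β = A / B := by
    rw [hl, ← Real.rpow_mul (by positivity), one_div_mul_cancel (by linarith), Real.rpow_one]
  have h := integral_comp_mul_left_Ioi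
    (fun q : ℝ => 1 / (A + B * |q| ^ β) * Real.cos (q * X)) 0 hl0
  rw [mul_zero, smul_eq_mul] at h
  have h2 : ∫ q in Set.Ioi (0 : ℝ), 1 / (A + B * |l * q| ^ β) * Real.cos (l * q * X)
      = ∫ q in Set.Ioi (0 : ℝ), 1 / A * (Real.cos (q * (l * X)) / (1 + q ^ β)) := by
    refine setIntegral_congr_fun measurableSet_Ioi fun q hq => ?_
    have hq0 : (0 : ℝ) < q := hq
    have : 0 < q ^ β := by positivity
    rw [abs_of_pos (mul_pos hl0 hq0), Real.mul_rpow hl0.le hq0.le, hlb,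
      show l * q * X = q * (l * X) by ring]
    field_simp
  rw [h2, integral_const_mul] at h
  have h3 : ∫ q in Set.Ioi (0 : ℝ), 1 / (A + B * |q| ^ β) * Real.cos (q * X)
      = l / A * ∫ q in Set.Ioi (0 : ℝ), Real.cos (q * (l * X)) / (1 + q ^ β) := by
    have : l * (l⁻¹ * ∫ q in Set.Ioi (0 : ℝ), 1 / (A + B * |q| ^ β) * Real.cos (q * X))
      = l * (1 / A * ∫ q in Set.Ioi (0 : ℝ), Real.cos (q * (l * X)) / (1 + q ^ β)) := by rw [h]
    rw [mul_inv_cancel_left₀ hl0.ne'] at this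
    rw [this]; ring
  rw [h3]
  ring

/-- The 9 counts the zero mode once and the Riemann error 4 for each half of the lattice. The other
term bounds the integral beyond the largest lattice momentum. -/
theorem abs_lattice_sum_sub_integral_le (hβ₁ : 1 < β) {A B : ℝ} (hA : 0 < A) (hB : 0 < B)
    {N W : ℕ} [NeZero N] (hN : 3 ≤ N) (hW : 1 ≤ W) (x : ZMod N) :
    |(∑ p : ZMod N, circCos p x * (1 / (A + B * |momentum N W p| ^ β))) / N
      - 1 / (Real.pi * W) *
        ∫ q in Set.Ioi (0 : ℝ), 1 / (A + B * |q| ^ β) * Real.cos (q * (rep x / W))|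
      ≤ 9 / (N * A) + 1 / (Real.pi * W) * (1 / (B * (β - 1))) := by
  have hW0 : (0 : ℝ) < W := by exact_mod_cast hW
  have hW1 : (1 : ℝ) ≤ W := by exact_mod_cast hW
  have hN0 : (0 : ℝ) < N := by exact_mod_cast (by omega : 0 < N)
  have hpi := Real.pi_gt_three
  set Δ : ℝ := 2 * Real.pi * W / N with hΔ
  have hΔ0 : 0 < Δ := by positivity
  set X : ℝ := rep x / W with hX
  set g : ℝ → ℝ := fun q => 1 / (A + B * |q| ^ β) with hg
  -- Nyquist condition: `ΔX = 2π rep x / N` and `|rep x| ≤ N/2`.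
  have hXΔ : |Δ * X| ≤ Real.pi := by
    obtain ⟨r1, r2, -⟩ := rep_spec x
    have r1' : -(N : ℝ) ≤ 2 * rep x := by exact_mod_cast r1
    have r2' : (2 * rep x : ℝ) ≤ N := by exact_mod_cast r2.le
    have e : Δ * X = Real.pi * (2 * rep x) / N := by rw [hΔ, hX]; field_simp
    rw [e, abs_le]
    constructor
    · rw [le_div_iff₀ hN0]; nlinarith
    · rw [div_le_iff₀ hN0]; nlinarith
  have hsum : ∑ p : ZMod N, circCos p x * g (momentum N W p) =
      ∑ p : ZMod N, g (rep p * Δ) * Real.cos (rep p * Δ * X) := by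
    refine Finset.sum_congr rfl fun p _ => ?_
    rw [circCos_eq, momentum, mul_comm]
    congr 2
    rw [hΔ, hX]; field_simp
  have hg0 : g 0 = 1 / A := by
    simp only [hg]
    rw [abs_zero, Real.zero_rpow (by linarith), mul_zero, add_zero]
  have hev := sum_rep_eq (N := N) (fun j : ℤ => g (j * Δ) * Real.cos (j * Δ * X)) fun j => by
    simp only [hg]
    push_cast
    rw [neg_mul, neg_mul, Real.cos_neg, abs_neg]
  simp only [Int.cast_zero, zero_mul, Real.cos_zero, mul_one, Int.cast_natCast] at hev
  have hhalf : ∀ n : ℕ, N ≤ 4 * n → |Δ * ∑ j ∈ Finset.Icc 1 n, g (j * Δ) * Real.cos (j * Δ * X)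
      - ∫ q in Set.Ioi 0, g q * Real.cos (q * X)| ≤ 4 * Δ * g 0 + 1 / (B * (β - 1)) := by
    intro n hn
    have h1 := abs_mul_sum_cos_sub_integral_le (continuous_one_div_add_rpow hβ₁ hA hB.le)
      (antitoneOn_one_div_add_rpow hβ₁ hA hB.le) (fun q => by positivity)
      (integrableOn_one_div_add_rpow hβ₁ hA hB) hΔ0 hXΔ n
    have h2 : 1 ≤ n * Δ := by
      have : (N : ℝ) ≤ 4 * n := by exact_mod_cast hn
      rw [hΔ, mul_div_assoc', le_div_iff₀ hN0]
      have e1 : 1 * 3 ≤ (W : ℝ) * Real.pi := mul_le_mul hW1 hpi.le (by norm_num) hW0.le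
      nlinarith
    exact h1.trans (by gcongr; exact integral_Ioi_one_div_add_rpow_le hβ₁ hA hB h2)
  have h1 := hhalf ((N - 1) / 2) (by omega)
  have h2 := hhalf (N / 2) (by omega)
  set I := ∫ q in Set.Ioi 0, g q * Real.cos (q * X)
  set S₁ := ∑ j ∈ Finset.Icc 1 ((N - 1) / 2), g (j * Δ) * Real.cos (j * Δ * X)
  set S₂ := ∑ j ∈ Finset.Icc 1 (N / 2), g (j * Δ) * Real.cos (j * Δ * X)
  set T := 1 / (B * (β - 1))
  have hND : N * Δ = 2 * (Real.pi * W) := by rw [hΔ]; field_simp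
  have hNΔ : 0 < N * Δ := by positivity
  have e1 : (∑ p : ZMod N, circCos p x * g (momentum N W p)) / N - 1 / (Real.pi * W) * I
      = (Δ * g 0 + (Δ * S₁ - I) + (Δ * S₂ - I)) / (N * Δ) := by
    rw [hsum, hev, eq_div_iff hNΔ.ne']
    have : 1 / (Real.pi * W) * I * (N * Δ) = 2 * I := by rw [hND]; field_simp
    rw [sub_mul, this]
    field_simp
    ring
  have e2 : 9 / (N * A) + 1 / (Real.pi * W) * T = (9 * (Δ * g 0) + 2 * T) / (N * Δ) := by
    rw [hg0, add_div]
    congr 1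
    · field_simp
    · rw [hND]; field_simp
  rw [e1, e2, abs_div, abs_of_pos hNΔ]
  gcongr
  have h0 : 0 ≤ Δ * g 0 := by rw [hg0]; positivity
  rw [abs_le] at h1 h2 ⊢
  constructor <;> linarith

end LimitProfile

/-! ### Assembly of the error estimate for the profile. -/

section Profile

variable {β h₀ : ℝ} {f σ : ℝ → ℝ}

theorem circEig_div {N : ℕ} [NeZero N] (v : ZMod N → ℝ) (Z : ℝ) (p : ZMod N) :
    circEig (fun u => v u / Z) p = circEig v p / Z := by
  rw [circEig, circEig, Finset.sum_div]
  exact Finset.sum_congr rfl fun u _ => by ring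

/-- The Green function of a circulant matrix minus a multiple of the limiting profile. -/
theorem abs_profile_sub_le {N : ℕ} [NeZero N] {v R : ZMod N → ℝ} {t I : ℝ} (g : ZMod N → ℝ)
    (ht0 : 0 ≤ t) (ht : t ≤ 1) {x : ZMod N} (hv : 0 ≤ v x) :
    |t * v x + (∑ p, circCos p x * R p) / N - t * I| ≤
      v x + (∑ p, |R p - t * g p|) / N + |(∑ p, circCos p x * g p) / N - I| := by
  have e : t * v x + (∑ p, circCos p x * R p) / N - t * I = t * v x +
      (∑ p, circCos p x * (R p - t * g p)) / N + t * ((∑ p, circCos p x * g p) / N - I) := by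
    have : ∑ p, circCos p x * (R p - t * g p)
        = ∑ p, circCos p x * R p - t * ∑ p, circCos p x * g p := by
      rw [Finset.mul_sum, ← Finset.sum_sub_distrib]
      exact Finset.sum_congr rfl fun p _ => by ring
    rw [this]; ring
  rw [e]
  refine (abs_add_le _ _).trans (add_le_add ((abs_add_le _ _).trans (add_le_add ?_ ?_)) ?_)
  · rw [abs_of_nonneg (mul_nonneg ht0 hv)]
    exact mul_le_of_le_one_left hv ht
  · rw [abs_div, Nat.abs_cast]
    gcongr
    refine (Finset.abs_sum_le_sum_abs _ _).trans (Finset.sum_le_sum fun p _ => ?_)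
    rw [abs_mul]
    exact mul_le_of_le_one_left (abs_nonneg _) (abs_circCos_le_one _ _)
  · rw [abs_mul, abs_of_nonneg ht0]
    exact mul_le_of_le_one_left (abs_nonneg _) ht

set_option maxHeartbeats 1000000 in
-- A quantitative form with `η` and `ν` as independent small parameters; the powers of `N` enter
-- only in the final theorem.
theorem exists_profile_bound (hβ₁ : 1 < β) (hβ₂ : β < 2) {κ : ℝ} (h0 : 0 < h₀) (hκ : 0 < κ)
    (hf : IsHeavyTailedDensity β h₀ f) (hσ : IsCutoff σ) :
    ∃ C η₀ ν₀ : ℝ, 0 < C ∧ 0 < η₀ ∧ 0 < ν₀ ∧ ∀ (N W : ℕ) [NeZero N] (E η ν : ℝ),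
      1 ≤ W → -2 + κ ≤ E → E ≤ 2 - κ → 0 < η → η ≤ η₀ → 0 ≤ ν → ν ≤ ν₀ →
      ((W : ℝ) / N) ^ β ≤ ν * η →
      0 < normConst f σ N W ∧
      IsUnit (1 - normSqM (E + η * Complex.I) • bandS f σ N W) ∧
      ∀ x : ZMod N,
        ‖((profile f σ N W (E + η * Complex.I) x 0 : ℝ) : ℂ) -
          ((normSqM (E + η * Complex.I) / (W * alpha E * η) *
            (alpha E * η / constB β h₀ f σ N W) ^ (1 / β) : ℝ) : ℂ) *
          limitV β ((alpha E * η / constB β h₀ f σ N W) ^ (1 / β) * ((rep x : ℝ) / W))‖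
        ≤ C / W * (1 + (ν + (η ^ (1 / (2 * β))) ^ (2 - β)) * (η ^ (1 / β)) ^ (1 - β) +
          (η ^ (1 / (2 * β))) ^ (1 - β) + W / N / η) := by
  obtain ⟨K, q₀, c, ε, hK, hq₀, hc, hε, hlow, hsymb⟩ := exists_symbol_bounds hβ₁ hβ₂ h0 hf hσ
  obtain ⟨C₁, hC₁, hm⟩ := exists_one_sub_normSqM_bound hκ
  have htc := tailConst_pos hβ₁ hβ₂
  set h : ℝ := h₀ * tailConst β with hh
  have hh0 : 0 < h := mul_pos h0 htc
  set C₂ := max 1 C₁ with hC₂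
  have hC21 : 1 ≤ C₂ := le_max_left _ _
  have hC2C : C₁ ≤ C₂ := le_max_right _ _
  obtain ⟨C₆, hC₆, hres⟩ := exists_resolvent_symbol_bound hβ₁ hβ₂ hK hq₀ hc hh0 hC21
  set C₇ := 7 + 2 * greenConst β with hC₇
  have hC70 : 0 < C₇ := by have := greenConst_nonneg β; positivity
  set b := h * 2 * (1 / K) with hb
  have hb0 : 0 < b := by positivity
  have hβ0 : 0 < β - 1 := by linarith
  have hbβ : 0 < 1 / (b * (β - 1)) := one_div_pos.2 (mul_pos hb0 hβ0)
  -- The bound on `η` keeps `t` close to 1. The bound on `ν` absorbs the `(W/N)^β` error of the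
  -- symbol into `η/4`, and its last entry forces `W ≤ εN` and `N ≥ 3`.
  refine ⟨K / c + C₆ * (3 * C₇ + K / c) + 9 + 1 / (b * (β - 1)), min 1 (1 / (4 * C₂)),
    min (min 1 (c / (4 * K))) ((min ε (1 / 3)) ^ β), by positivity, by positivity, by positivity, ?_⟩
  intro N W _ E η ν hW hE1 hE2 hη hηs hν hνs hWN
  have hη1 : η ≤ 1 := hηs.trans (min_le_left _ _)
  have hη4 : C₂ * η ≤ 1 / 4 := by
    have h1 := hηs.trans (min_le_right _ _)
    rw [le_div_iff₀ (by positivity)] at h1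
    linarith
  have hν1 : ν ≤ 1 := hνs.trans ((min_le_left _ _).trans (min_le_left _ _))
  have hνK : K / c * ν ≤ 1 / 4 := by
    have h1 := hνs.trans ((min_le_left _ _).trans (min_le_right _ _))
    rw [le_div_iff₀ (by positivity)] at h1
    rw [div_mul_eq_mul_div, div_le_iff₀ hc]
    linarith
  have hN0 : (0 : ℝ) < N := by exact_mod_cast Nat.pos_of_ne_zero (NeZero.ne N)
  have hW0 : (0 : ℝ) < W := by exact_mod_cast hW
  have hW1 : (1 : ℝ) ≤ W := by exact_mod_cast hW
  have hWN0 : (0 : ℝ) < W / N := by positivity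
  have hWNε : (W : ℝ) / N ≤ min ε (1 / 3) := by
    have h1 : ((W : ℝ) / N) ^ β ≤ (min ε (1 / 3)) ^ β :=
      hWN.trans ((mul_le_of_le_one_right hν hη1).trans (hνs.trans (min_le_right _ _)))
    exact (Real.rpow_le_rpow_iff hWN0.le (by positivity) (by linarith)).1 h1
  have hWε : (W : ℝ) ≤ ε * N := by
    rw [← div_le_iff₀ hN0]; exact hWNε.trans (min_le_left _ _)
  have hN3 : 3 ≤ N := by
    have h1 := hWNε.trans (min_le_right _ _)
    rw [div_le_iff₀ hN0] at h1
    have : (3 : ℝ) ≤ N := by linarith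
    exact_mod_cast this
  -- The momentum spacing resolves the scale `η^(1/β)`, and hence every larger scale at which
  -- lattice sums are taken.
  have hWη : (W : ℝ) / N ≤ η ^ (1 / β) := by
    have h1 : ((W : ℝ) / N) ^ β ≤ η := hWN.trans (mul_le_of_le_one_left hη.le hν1)
    calc (W : ℝ) / N = (((W : ℝ) / N) ^ β) ^ (1 / β) := by
          rw [← Real.rpow_mul hWN0.le, mul_one_div_cancel (by linarith), Real.rpow_one]
      _ ≤ _ := Real.rpow_le_rpow (by positivity) h1 (by positivity)
  obtain ⟨hZl, hZu, hwt, hp⟩ := hsymb N W hW hWε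
  obtain ⟨ht1, htα, hα1, hαC⟩ := hm E η hE1 hE2 hη hη1
  set t := normSqM (E + η * Complex.I) with ht
  have ht0 : 0 ≤ t := sq_nonneg _
  set α := alpha E with hα
  set Z := normConst f σ N W with hZ
  have hZ0 : 0 < Z := lt_of_lt_of_le (by positivity) hZl
  set v : ZMod N → ℝ := fun u => weight f σ N W u / Z with hv
  have hv0 : ∀ u, 0 ≤ v u := fun u => div_nonneg (weight_nonneg hf hσ u) hZ0.le
  have hvn : ∀ u, v (-u) = v u := fun u => by simp only [hv, weight_neg hf hσ]
  have hv1 : ∑ u, v u = 1 := by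
    simp only [hv]; rw [← Finset.sum_div, ← normConst, div_self hZ0.ne']
  have hvK : ∀ u, v u ≤ K / c / W := by
    intro u
    calc v u ≤ K / (c * W) := by simp only [hv]; gcongr; exact hwt u
      _ = _ := by rw [div_div]
  have hv2 : ∑ u, v u ^ 2 ≤ K / c / W := by
    calc ∑ u, v u ^ 2 ≤ ∑ u, K / c / W * v u := by
          refine Finset.sum_le_sum fun u _ => ?_
          rw [sq]; exact mul_le_mul_of_nonneg_right (hvK u) (hv0 u)
      _ = _ := by rw [← Finset.mul_sum, hv1, mul_one]
  set w : ℝ := W / Z with hw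
  have hwl : 1 / K ≤ w := by rw [hw, div_le_div_iff₀ hK hZ0]; linarith
  have hwu : w ≤ 1 / c := by rw [hw, div_le_div_iff₀ hZ0 hc]; linarith
  have hB : constB β h₀ f σ N W = h * 2 * w := by
    rw [constB, integral_one_sub_cos_div_abs_rpow, hw, hh]; ring
  rw [hB]
  have hbB : b ≤ h * 2 * w := by rw [hb]; gcongr
  have hB0 : 0 < h * 2 * w := hb0.trans_le hbB
  -- The geometric mean of `η^(1/β)` and 1: both `r^(2-β)` and `r^(1-β)` relative to `η^(1/β-1)` are
  -- then positive powers of `η`.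
  set r := η ^ (1 / (2 * β)) with hr
  have hr0 : 0 < r := by positivity
  set A := α * η with hA
  have hA0 : 0 < A := by positivity
  have hηA : η ≤ A := le_mul_of_one_le_left hη.le hα1
  have hpt : ∀ p : ZMod N, 0 < 1 - t * circEig v p ∧
      |(t * circEig v p) ^ 2 / (1 - t * circEig v p)
        - t * (1 / (A + h * 2 * w * |momentum N W p| ^ β))| ≤
        C₆ * (1 / (1 + |momentum N W p| ^ β) +
          (ν + r ^ (2 - β)) * (1 / (η + |momentum N W p| ^ β))
          + 1 / (r ^ β + |momentum N W p| ^ β) + circEig v p ^ 2) := by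
    intro p
    obtain ⟨hp1, hp2⟩ := hp p
    have ha : circEig v p = circEig (weight f σ N W) p / Z := circEig_div _ _ _
    have h1a : 1 - circEig v p = w * ((Z - circEig (weight f σ N W) p) / W) := by
      rw [ha, hw]; field_simp
    rw [mul_one_div]
    refine hres t (circEig v p) w |momentum N W p| η ν (((W : ℝ) / N) ^ β) α r hwl hwu
      (abs_nonneg _) hr0 hη hη4 hα1 (hαC.trans hC2C) ht1
      (htα.trans (mul_le_mul_of_nonneg_right hC2C (sq_nonneg η)))
      ((abs_circEig_le hv0 p).trans hv1.le) hν hWN hνK ?_ ?_ ?_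
    · rw [h1a, show w * ((Z - circEig (weight f σ N W) p) / W) - h * 2 * w * |momentum N W p| ^ β
        = w * ((Z - circEig (weight f σ N W) p) / W - h₀ * (2 * tailConst β)
          * |momentum N W p| ^ β) by rw [hh]; ring, abs_mul, abs_of_pos (by positivity), sq_abs]
      gcongr
    · intro hy
      rw [sq_abs]
      exact hlow _ hy
    · intro hy
      rw [h1a]
      have := hp2 hy
      calc c * w = w * (c * W / W) := by field_simp
        _ ≤ _ := by gcongr
  have hne : ∀ p, 1 - t * circEig v p ≠ 0 := fun p => (hpt p).1.ne'
  have hband : bandS f σ N W = Matrix.of fun x y => v (x - y) := rfl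
  refine ⟨hZ0, ?_, fun x => ?_⟩
  · rw [hband]
    exact IsUnit.of_mul_eq_one _ (one_sub_smul_circulant_mul hvn hne)
  set Δ : ℝ := 2 * Real.pi * W / N with hΔ
  have hΔ0 : 0 < Δ := by positivity
  have hΔ7 : Δ ≤ 7 * (W / N) := by
    have : Δ = 2 * Real.pi * (W / N) := by rw [hΔ]; ring
    rw [this]
    have := Real.pi_lt_d2
    gcongr
    linarith
  have hηr : η ^ (1 / β) ≤ r := Real.rpow_le_rpow_of_exponent_ge hη hη1 (by
    rw [div_le_div_iff₀ (by positivity) (by positivity)]; linarith)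
  have hr1 : r ≤ 1 := Real.rpow_le_one hη.le hη1 (by positivity)
  have hS : ∀ s : ℝ, η ^ (1 / β) ≤ s →
      (∑ p : ZMod N, 1 / (s ^ β + |momentum N W p| ^ β)) / N ≤ C₇ / W * s ^ (1 - β) := by
    intro s hs
    have hs0 : 0 < s := lt_of_lt_of_le (by positivity) hs
    have h1 := sum_one_div_rpow_add_rpow_le hβ₁ hs0 hΔ0 (by linarith) N
    calc _ ≤ C₇ * (s ^ (1 - β) / Δ) / N := by gcongr; exact h1
      _ = C₇ / (2 * Real.pi * W) * s ^ (1 - β) := by rw [hΔ]; field_simp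
      _ ≤ _ := by
        gcongr
        have := Real.pi_gt_three
        nlinarith
  have hS1 := hS 1 (hηr.trans hr1)
  have hS2 := hS (η ^ (1 / β)) le_rfl
  have hS3 := hS r hηr
  have hηβ : (η ^ (1 / β)) ^ β = η := by
    rw [← Real.rpow_mul hη.le, one_div_mul_cancel (by linarith), Real.rpow_one]
  rw [Real.one_rpow, Real.one_rpow, mul_one] at hS1
  rw [hηβ] at hS2
  have hS4 : (∑ p, circEig v p ^ 2) / N ≤ K / c / W := by
    rw [sum_sq_circEig hvn, mul_div_cancel_left₀ _ hN0.ne']; exact hv2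
  have hsumR : (∑ p : ZMod N, |(t * circEig v p) ^ 2 / (1 - t * circEig v p)
        - t * (1 / (A + h * 2 * w * |momentum N W p| ^ β))|) / N ≤
      C₆ * (C₇ / W + (ν + r ^ (2 - β)) * (C₇ / W * (η ^ (1 / β)) ^ (1 - β)) +
        C₇ / W * r ^ (1 - β) + K / c / W) := by
    have hr2 : 0 < r ^ (2 - β) := by positivity
    calc _ ≤ (∑ p : ZMod N, C₆ * (1 / (1 + |momentum N W p| ^ β) +
          (ν + r ^ (2 - β)) * (1 / (η + |momentum N W p| ^ β))
          + 1 / (r ^ β + |momentum N W p| ^ β) + circEig v p ^ 2)) / (N : ℝ) := by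
          gcongr with p; exact (hpt p).2
      _ = C₆ * ((∑ p : ZMod N, 1 / (1 + |momentum N W p| ^ β)) / N +
          (ν + r ^ (2 - β)) * ((∑ p : ZMod N, 1 / (η + |momentum N W p| ^ β)) / N) +
          (∑ p : ZMod N, 1 / (r ^ β + |momentum N W p| ^ β)) / N +
          (∑ p, circEig v p ^ 2) / N) := by
          rw [← Finset.mul_sum, Finset.sum_add_distrib, Finset.sum_add_distrib,
            Finset.sum_add_distrib, ← Finset.mul_sum]
          ring
      _ ≤ _ := by gcongr
  have hlat := abs_lattice_sum_sub_integral_le hβ₁ hA0 hB0 hN3 hW x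
  have hprof : profile f σ N W (E + η * Complex.I) x 0 = t * v x + (∑ p, circCos p x *
      ((t * circEig v p) ^ 2 / (1 - t * circEig v p))) / N :=
    smul_circulant_mul_inv_apply hvn hne x
  rw [hprof, mul_assoc (W : ℝ), ← hA, mul_limitV_eq hβ₁ hA0 hB0, ← Complex.ofReal_sub,
    Complex.norm_real, Real.norm_eq_abs]
  refine (abs_profile_sub_le _ ht0 ht1.le (hv0 x)).trans
    ((add_le_add (add_le_add (hvK x) hsumR) hlat).trans ?_)
  set P := (ν + r ^ (2 - β)) * (η ^ (1 / β)) ^ (1 - β) with hP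
  have hP0 : 0 ≤ P := by positivity
  set Q := r ^ (1 - β) with hQ
  have hQ0 : 0 < Q := by positivity
  have hR0 : 0 < (W : ℝ) / N / η := by positivity
  have l1 : 9 / (N * A) ≤ 9 * (W / N / η) / W := by
    calc 9 / (N * A) ≤ 9 / (N * η) := by gcongr
      _ = _ := by field_simp
  have l2 : 1 / (Real.pi * W) * (1 / (h * 2 * w * (β - 1))) ≤ 1 / (b * (β - 1)) / W := by
    calc _ ≤ 1 / (1 * W) * (1 / (b * (β - 1))) := by
          gcongr
          linarith [Real.pi_gt_three]
      _ = _ := by field_simp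
  calc _ ≤ K / c / W + C₆ * (C₇ / W + (ν + r ^ (2 - β)) * (C₇ / W * (η ^ (1 / β)) ^ (1 - β)) +
        C₇ / W * Q + K / c / W) + (9 * (W / N / η) / W + 1 / (b * (β - 1)) / W) := by gcongr
    _ = (K / c + C₆ * (C₇ + C₇ * P + C₇ * Q + K / c) + 9 * (W / N / η) + 1 / (b * (β - 1))) / W := by
        rw [hP]; ring
    _ ≤ ((K / c + C₆ * (3 * C₇ + K / c) + 9 + 1 / (b * (β - 1))) * (1 + P + Q + W / N / η)) / W := by
        gcongr
        have hKc : 0 < K / c := by positivity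
        have x1 : 0 ≤ C₆ * C₇ := by positivity
        have x2 : 0 ≤ C₆ * (K / c) := by positivity
        have y1 := mul_nonneg hKc.le hP0
        have y2 := mul_nonneg hKc.le hQ0.le
        have y3 := mul_nonneg hKc.le hR0.le
        have y4 := mul_nonneg x1 hP0
        have y5 := mul_nonneg x1 hQ0.le
        have y6 := mul_nonneg x1 hR0.le
        have y7 := mul_nonneg x2 hP0
        have y8 := mul_nonneg x2 hQ0.le
        have y9 := mul_nonneg x2 hR0.le
        have z1 := mul_nonneg hbβ.le hP0
        have z2 := mul_nonneg hbβ.le hQ0.le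
        have z3 := mul_nonneg hbβ.le hR0.le
        linarith
    _ = _ := by ring

end Profile

end HeavyTailBand

end

/-! ### The main theorem: conversion of all errors into powers of `W`. -/

theorem mainTheorem11 (β : ℝ) (hβ₁ : 1 < β) (hβ₂ : β < 2)
    (τ₁ τ₂ : ℝ) (hτ₁ : 0 < τ₁) (hτ₂ : 0 < τ₂) :
    ∃ c : ℝ, 0 < c ∧
      ∀ (h₀ : ℝ) (f σ : ℝ → ℝ) (δ κ : ℝ), 0 < h₀ → 0 < δ → 0 < κ →
        HeavyTailBand.IsHeavyTailedDensity β h₀ f → HeavyTailBand.IsCutoff σ →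
        ∃ (C : ℝ) (N₀ : ℕ), ∀ (N W : ℕ) [NeZero N] (E η : ℝ),
          N₀ ≤ N → (N : ℝ) ^ δ ≤ W → W ≤ N →
          -2 + κ ≤ E → E ≤ 2 - κ →
          ((W : ℝ) / N) ^ β ≤ (N : ℝ) ^ (-τ₁) * η → η ≤ (N : ℝ) ^ (-τ₂) →
          0 < HeavyTailBand.normConst f σ N W ∧
          IsUnit (1 - HeavyTailBand.normSqM (E + η * Complex.I) •
            HeavyTailBand.bandS f σ N W) ∧
          ∀ x : ZMod N,
            ‖((HeavyTailBand.profile f σ N W (E + η * Complex.I) x 0 : ℝ) : ℂ) -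
              ((HeavyTailBand.normSqM (E + η * Complex.I) /
                  (W * HeavyTailBand.alpha E * η) *
                (HeavyTailBand.alpha E * η / HeavyTailBand.constB β h₀ f σ N W) ^ (1 / β) : ℝ) : ℂ) *
              HeavyTailBand.limitV β
                ((HeavyTailBand.alpha E * η / HeavyTailBand.constB β h₀ f σ N W) ^ (1 / β) *
                  ((HeavyTailBand.rep x : ℝ) / W))‖
            ≤ C * (η ^ (1 / β - 1) / (W : ℝ) ^ (1 + c)) := by
  have hβ0 : 0 < β := by linarith
  -- The two exponents are the gains in `η` from `r^(2-β)` and from `r^(1-β) / η^(1/β-1)`.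
  set s : ℝ := min ((2 - β) / (2 * β)) ((β - 1) / (2 * β)) with hs
  have hs0 : 0 < s := lt_min (div_pos (by linarith) (by linarith))
    (div_pos (by linarith) (by linarith))
  -- `τ₁/β` comes from `W/(Nη) ≤ N^(-τ₁/β) η^(1/β-1)`, and `τ₂ s` from `η^s ≤ N^(-τ₂ s)`.
  set c : ℝ := min (τ₁ / β) (τ₂ * s) with hc
  have hc0 : 0 < c := by positivity
  refine ⟨c, hc0, fun h₀ f σ δ κ h0 hδ hκ hf hσ => ?_⟩
  obtain ⟨C, η₀, ν₀, hC, hη₀, hν₀, hmain⟩ :=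
    HeavyTailBand.exists_profile_bound hβ₁ hβ₂ h0 hκ hf hσ
  have hlim : ∀ τ : ℝ, 0 < τ → ∀ a : ℝ, 0 < a → ∀ᶠ N : ℕ in Filter.atTop, (N : ℝ) ^ (-τ) ≤ a :=
    fun τ hτ a ha => ((tendsto_rpow_neg_atTop hτ).comp
      tendsto_natCast_atTop_atTop).eventually_le_const ha
  obtain ⟨N₀, hN₀⟩ := Filter.eventually_atTop.1 ((hlim τ₁ hτ₁ ν₀ hν₀).and (hlim τ₂ hτ₂ η₀ hη₀))
  -- The bracket in the profile bound contributes `1 + 2 + 1 + 1` multiples of `η^(1/β-1) W^(-c)`.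
  refine ⟨C * 5, N₀, fun N W _ E η hN hNW hWN hE1 hE2 hη1 hη2 => ?_⟩
  obtain ⟨hνs, hηs⟩ := hN₀ N hN
  have hN1 : (1 : ℝ) ≤ N := by exact_mod_cast Nat.one_le_iff_ne_zero.2 (NeZero.ne N)
  have hN0 : (0 : ℝ) < N := by linarith
  have hW1 : (1 : ℝ) ≤ W := (Real.one_le_rpow hN1 hδ.le).trans hNW
  have hW0 : (0 : ℝ) < W := by linarith
  have hWN' : (W : ℝ) ≤ N := by exact_mod_cast hWN
  set ν : ℝ := (N : ℝ) ^ (-τ₁) with hν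
  have hν0 : 0 < ν := by positivity
  have hWNp : (0 : ℝ) < W / N := by positivity
  -- Positivity of `η` is forced by `0 < (W/N)^β ≤ νη`.
  have hη0 : 0 < η := by
    have : 0 < ν * η := lt_of_lt_of_le (by positivity) hη1
    exact pos_of_mul_pos_right this hν0.le
  obtain ⟨r1, r2, r3⟩ := hmain N W E η ν (by exact_mod_cast hW1) hE1 hE2 hη0 (hη2.trans hηs) hν0.le
    hνs hη1
  refine ⟨r1, r2, fun x => (r3 x).trans ?_⟩
  have hηle : η ≤ 1 := hη2.trans (Real.rpow_le_one_of_one_le_of_nonpos hN1 (by linarith))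
  set e : ℝ := η ^ (1 / β - 1) with he
  have he0 : 0 < e := by positivity
  set L : ℝ := (W : ℝ) ^ (-c) with hL
  have hNL : ∀ u : ℝ, c ≤ u → (N : ℝ) ^ (-u) ≤ L := fun u hu =>
    (Real.rpow_le_rpow_of_exponent_le hN1 (neg_le_neg hu)).trans
      (Real.rpow_le_rpow_of_nonpos hW0 hWN' (by linarith))
  have hηL : ∀ u : ℝ, s ≤ u → η ^ u ≤ L := fun u hu => by
    calc η ^ u ≤ η ^ s := Real.rpow_le_rpow_of_exponent_ge hη0 hηle hu
      _ ≤ ((N : ℝ) ^ (-τ₂)) ^ s := Real.rpow_le_rpow hη0.le hη2 hs0.le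
      _ = (N : ℝ) ^ (-(τ₂ * s)) := by rw [← Real.rpow_mul hN0.le]; ring_nf
      _ ≤ L := hNL _ (min_le_right _ _)
  have hs2 : (β - 1) / (2 * β) ≤ (β - 1) / β := by
    gcongr
    linarith
  have hs3 : s ≤ (β - 1) / (2 * β) := min_le_right _ _
  have b1 : 1 ≤ e * L := by
    calc (1 : ℝ) = e * η ^ ((β - 1) / β) := by
          rw [he, ← Real.rpow_add hη0, show 1 / β - 1 + (β - 1) / β = 0 by field_simp; ring,
            Real.rpow_zero]
      _ ≤ e * L := by gcongr; exact hηL _ (hs3.trans hs2)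
  have b2 : (η ^ (1 / β)) ^ (1 - β) = e := by
    rw [he, ← Real.rpow_mul hη0.le]; congr 1; field_simp
  have b3 : (η ^ (1 / (2 * β))) ^ (2 - β) ≤ L := by
    rw [← Real.rpow_mul hη0.le, one_div_mul_eq_div]
    exact hηL _ (min_le_left _ _)
  have b4 : (η ^ (1 / (2 * β))) ^ (1 - β) ≤ e * L := by
    have : (η ^ (1 / (2 * β))) ^ (1 - β) = e * η ^ ((β - 1) / (2 * β)) := by
      rw [he, ← Real.rpow_mul hη0.le, ← Real.rpow_add hη0]
      congr 1; field_simp; ring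
    rw [this]
    gcongr
    exact hηL _ hs3
  have hcτ : c ≤ τ₁ / β := min_le_left _ _
  have b5 : ν ≤ L := hNL _ (hcτ.trans (div_le_self hτ₁.le hβ₁.le))
  have b6 : (W : ℝ) / N / η ≤ e * L := by
    have h1 : (W : ℝ) / N ≤ (ν * η) ^ (1 / β) := by
      calc (W : ℝ) / N = (((W : ℝ) / N) ^ β) ^ (1 / β) := by
            rw [← Real.rpow_mul hWNp.le, mul_one_div_cancel hβ0.ne', Real.rpow_one]
        _ ≤ _ := Real.rpow_le_rpow (by positivity) hη1 (by positivity)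
    have h2 : ν ^ (1 / β) ≤ L := by
      rw [hν, ← Real.rpow_mul hN0.le, neg_mul, mul_one_div]
      exact hNL _ hcτ
    rw [Real.mul_rpow hν0.le hη0.le] at h1
    have h3 : e = η ^ (1 / β) / η := by rw [he, Real.rpow_sub hη0, Real.rpow_one]
    rw [h3]
    calc (W : ℝ) / N / η ≤ ν ^ (1 / β) * η ^ (1 / β) / η := by gcongr
      _ ≤ L * η ^ (1 / β) / η := by gcongr
      _ = _ := by ring
  have b7 : (W : ℝ) ^ (1 + c) = W / L := by
    rw [hL, Real.rpow_neg hW0.le, div_inv_eq_mul, Real.rpow_add hW0, Real.rpow_one]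
  have hL0 : 0 < L := by positivity
  rw [b2, b7]
  have b8 : (ν + (η ^ (1 / (2 * β))) ^ (2 - β)) * e ≤ 2 * (e * L) := by
    calc _ ≤ (L + L) * e := by gcongr
      _ = _ := by ring
  calc _ ≤ C / W * (e * L + 2 * (e * L) + e * L + e * L) := by gcongr
    _ = _ := by field_simp; ring
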